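/- Fix countably many variables. A signature consists of function symbols, named by natural numbers, each with a fixed arity; some of the binary symbols $f$ are marked as associative-commutative (AC), and all the others are free; symbols of arity $0$ are constants. Terms are built from variables, constants and function symbols as usual. Write $s =_{AC} t$ for the least congruence on terms that contains all instances of $f(s,t)=f(t,s)$ and $f(s,f(t,u))=f(f(s,t),u)$ for the AC symbols $f$. A substitution $\theta$ is a partial map from variables to terms such that the term assigned to a variable $x$ does not contain $x$; $t\theta$ is obtained from $t$ by simultaneously replacing the variables in the domain of $\theta$. Two terms $t_1,t_2$ are AC-unifiable if $t_1\theta =_{AC} t_2\theta$ for some substitution $\theta$. A DO-term is a term in which every variable that occurs in it occurs only once. **Proposition.** There is an algorithm (a deterministic multi-stack Turing machine) that, given two DO-terms $t_1$ and $t_2$ over a common signature that have no variable in common, decides whether $t_1$ and $t_2$ are AC-unifiable, in time polynomial in the length of the input. Here the input is the pair $(t_1,t_2)$ in the usual parenthesised prefix notation over a finite alphabet, with the names of variables and function symbols written in binary and each occurrence of a function symbol marked as AC or free. The machine and the polynomial do not depend on the signature. -/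

import Mathlib

/-- A signature: a set `symbols` of function symbols (named by natural numbers), the number of
arguments of each of them, and a mark on those that are associative and commutative, which are
binary. The unmarked symbols are ordinary (free) function symbols. Symbols with no arguments are
the constants. -/
structure ACSignature where
  symbols : Set ℕ
  arity : ℕ → ℕ
  isAC : ℕ → Bool
  arity_of_isAC : ∀ f ∈ symbols, isAC f = true → arity f = 2

namespace ACSignature

/-- The purely functional first-order language of a signature. -/
def language (S : ACSignature) : FirstOrder.Language where
  Functions n := {f : ℕ // f ∈ S.symbols ∧ S.arity f = n}
  Relations _ := Empty

/-- Terms over the signature, with variables named by natural numbers. -/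
abbrev Term (S : ACSignature) : Type := S.language.Term ℕ

variable {S : ACSignature}

/-- The number of occurrences of the variable `x` in a term. -/
def occurrences (x : ℕ) : S.Term → ℕ
  | .var y => if y = x then 1 else 0
  | .func _ ts => ∑ i, occurrences x (ts i)

/-- A DO-term: every variable that occurs in the term occurs in it only once. -/
def IsDO (t : S.Term) : Prop :=
  ∀ x ∈ t.varFinset, occurrences x t = 1

/-- Equality of terms modulo associativity and commutativity of the marked symbols: the least
congruence that contains all instances of the two laws. -/
inductive ACEq : S.Term → S.Term → Prop
  | refl (t : S.Term) : ACEq t t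
  | symm {s t : S.Term} : ACEq s t → ACEq t s
  | trans {s t u : S.Term} : ACEq s t → ACEq t u → ACEq s u
  | congr {n : ℕ} (f : S.language.Functions n) {ss ts : Fin n → S.Term} :
      (∀ i, ACEq (ss i) (ts i)) → ACEq (.func f ss) (.func f ts)
  | comm (f : S.language.Functions 2) (hf : S.isAC f.1 = true) (s t : S.Term) :
      ACEq (.func f ![s, t]) (.func f ![t, s])
  | assoc (f : S.language.Functions 2) (hf : S.isAC f.1 = true) (s t u : S.Term) :
      ACEq (.func f ![s, .func f ![t, u]]) (.func f ![.func f ![s, t], u])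

/-- A substitution: a partial map from variables to terms such that the term put in place of a
variable `x` does not contain `x`. -/
structure Substitution (S : ACSignature) where
  map : ℕ → Option S.Term
  not_mem : ∀ x t, map x = some t → x ∉ t.varFinset

/-- The term obtained by simultaneously replacing the variables in the domain of `θ`. -/
def Substitution.apply (θ : Substitution S) (t : S.Term) : S.Term :=
  t.subst fun x => (θ.map x).getD (.var x)

/-- Unifiability modulo associativity and commutativity. -/
def ACUnifiable (s t : S.Term) : Prop :=
  ∃ θ : Substitution S, ACEq (θ.apply s) (θ.apply t)

end ACSignature

/-- The finite alphabet in which terms are written. -/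
inductive TermToken
  | variableTag
  | freeTag
  | acTag
  | bit (b : Bool)
  | openParen
  | closeParen
  | comma
  deriving DecidableEq, Fintype

namespace ACSignature

variable {S : ACSignature}

/-- The usual linear notation of a term: a variable is a tag followed by its name in binary; a
compound term is a tag that tells whether its head symbol is associative-commutative or free,
followed by the name of that symbol in binary and the arguments in parentheses. -/
def encodeTerm : S.Term → List TermToken
  | .var x => .variableTag :: (Computability.encodeNat x).map .bit
  | .func f ts =>
      (if S.isAC f.1 = true then TermToken.acTag else TermToken.freeTag) ::
        ((Computability.encodeNat f.1).map .bit ++ [.openParen] ++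
          (List.ofFn fun i => encodeTerm (ts i)).flatten ++ [.closeParen])

end ACSignature

/-- An instance of associative-commutative unification: a signature and two terms over it. -/
structure ACUnificationInstance where
  sig : ACSignature
  t₁ : sig.Term
  t₂ : sig.Term

/-- The word that a machine receives as input: the two terms, separated by a comma. -/
def ACUnificationInstance.encode (I : ACUnificationInstance) : List TermToken :=
  ACSignature.encodeTerm I.t₁ ++ [.comma] ++ ACSignature.encodeTerm I.t₂

/-- The predicate `P` is decidable in polynomial time, its arguments being given as words through
`enc`: some Turing machine outputs, for every `a`, the truth value of `P a` within a number of
steps that is bounded by a fixed polynomial in the length of `enc a`. -/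
def DecidableInPolyTime {α Γ : Type} (enc : α → List Γ) (P : α → Prop) : Prop :=
  ∃ f : α → Bool, (∀ a, f a = true ↔ P a) ∧
    Nonempty (Turing.TM2ComputableInPolyTime enc Computability.encodeBool f)

/-! Since no variable occurs twice in the two terms together, unification problems for different
arguments do not interact: unifiers of pairs with disjoint variables can be glued. A variable
unifies with every term that avoids it, and compound terms with different heads never unify. Under a
common free head, unifiability means unifiability argument by argument (`unif_free`).

Under an AC head both terms are flattened to multisets of arguments. If each side has a variable
among these arguments, the terms unify: each variable absorbs the rest of the other side
(`unif_of_mem_flat`). If `t` has no variable argument, every argument of `t` remains a single factor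
after substitution, while each argument of `s` becomes at least one factor. So the arguments of `s`
must be assigned injectively to arguments of `t` that they unify with, and this assignment must be
onto unless a variable of `s` can absorb what is left over (`unif_iff_matches`). This is bipartite
matching.

Matching is decided by an auction with integer prices: a blocked row would contradict Hall's
condition, and the sum of the prices bounds the number of rounds (`Auction.assignable_iff`).
Unifiability of all pairs of subterms is tabulated in rounds; an entry is correct once the number of
rounds reaches the size of its first tree (`edge_table_iff`). The trees forget the names of
variables, which linearity makes irrelevant.

For the running time, a small language of stack programs is compiled to machines with exact step
counts (`Exec.steps`). `PT` is the class of functions on tree-coded data that such programs compute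
in polynomial time. It is closed under composition, case distinction, and iteration along which
sizes stay polynomially bounded. The algorithm is built inside `PT`, and `PT.computableInPolyTime`
adds input and output. -/

/-- Structured programs acting on finitely many stacks. -/
inductive StackProg {K : Type} (Γ : K → Type) : Type
  | skip : StackProg Γ
  | push (k : K) (x : Γ k) : StackProg Γ
  | pop (k : K) (branch : Option (Γ k) → StackProg Γ) : StackProg Γ
  | loop (k : K) (body : Γ k → StackProg Γ) : StackProg Γ
  | seq (p q : StackProg Γ) : StackProg Γ

/-! ### Compilation of structured stack programs into machines -/

namespace StackProg

open Turing Function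

variable {K : Type} {Γ : K → Type}

/-- The labels of the machine code of a program. -/
def Label : StackProg Γ → Type
  | skip => Unit
  | push _ _ => Unit
  | pop _ br => Option (Σ o, Label (br o))
  | loop _ b => Option (Σ x, Label (b x))
  | seq p q => Label p ⊕ Label q

/-- Continuations and loop bodies are indexed by the popped symbol, so finiteness of the alphabets
is what keeps the machine code finite. -/
theorem finite_label [∀ k, Finite (Γ k)] : ∀ p : StackProg Γ, Finite p.Label
  | skip => inferInstanceAs (Finite Unit)
  | push _ _ => inferInstanceAs (Finite Unit)
  | pop _ br =>
    have := fun o => finite_label (br o)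
    inferInstanceAs (Finite (Option (Σ o, Label (br o))))
  | loop _ b =>
    have := fun o => finite_label (b o)
    inferInstanceAs (Finite (Option (Σ o, Label (b o))))
  | seq p q =>
    have := finite_label p
    have := finite_label q
    inferInstanceAs (Finite (Label p ⊕ Label q))

/-- The label at which a program starts. -/
def entry : ∀ p : StackProg Γ, p.Label
  | skip => ()
  | push _ _ => ()
  | pop _ _ => none
  | loop _ _ => none
  | seq p _ => Sum.inl p.entry

variable [DecidableEq K]

/-- The internal memory of the compiled machines: the last symbol that was popped. -/
abbrev Mem (Γ : K → Type) : Type := Option (Σ k, Option (Γ k))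

/-- Read the last popped symbol, if it came from the stack `k`. -/
def Mem.read (v : Mem Γ) (k : K) : Option (Γ k) :=
  match v with
  | none => none
  | some ⟨k', o⟩ => if h : k' = k then h ▸ o else none

@[simp] theorem Mem.read_some (k : K) (o : Option (Γ k)) : Mem.read (some ⟨k, o⟩) k = o := by
  simp [Mem.read]

/-- The machine code of a program, its labels being embedded by `e` and control being passed to
the label `x` at the end. -/
def code {Λ : Type} : ∀ p : StackProg Γ, (p.Label → Λ) → Λ → p.Label → TM2.Stmt Γ Λ (Mem Γ)
  | skip, _, x, _ => .goto fun _ => x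
  | push k a, _, x, _ => .push k (fun _ => a) (.goto fun _ => x)
  | pop k br, e, _, none =>
      .pop k (fun _ o => some ⟨k, o⟩) (.goto fun v => e (some ⟨v.read k, (br (v.read k)).entry⟩))
  | pop _ br, e, x, some ⟨o, l⟩ => (br o).code (fun l' => e (some ⟨o, l'⟩)) x l
  | loop k b, e, x, none =>
      .pop k (fun _ o => some ⟨k, o⟩) (.goto fun v =>
        match v.read k with
        | none => x
        | some a => e (some ⟨a, (b a).entry⟩))
  | loop _ b, e, _, some ⟨a, l⟩ => (b a).code (fun l' => e (some ⟨a, l'⟩)) (e none) l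
  | seq p q, e, _, .inl l => p.code (fun l' => e (.inl l')) (e (.inr q.entry)) l
  | seq _ q, e, x, .inr l => q.code (fun l' => e (.inr l')) x l

/-- `Exec p S S' t`: from the stacks `S` the program `p` runs `t` steps and ends with `S'`. -/
inductive Exec : StackProg Γ → (∀ k, List (Γ k)) → (∀ k, List (Γ k)) → ℕ → Prop
  | skip (S) : Exec skip S S 1
  | push (S k a) : Exec (push k a) S (update S k (a :: S k)) 1
  | pop {S S' k br t} : Exec (br (S k).head?) (update S k (S k).tail) S' t →
      Exec (pop k br) S S' (t + 1)
  | loop_nil {S k b} : S k = [] → Exec (loop k b) S S 1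
  | loop_cons {S S' S'' k b a l t t'} : S k = a :: l → Exec (b a) (update S k l) S' t →
      Exec (loop k b) S' S'' t' → Exec (loop k b) S S'' (t + t' + 1)
  | seq {S S' S'' p q t t'} : Exec p S S' t → Exec q S' S'' t' → Exec (seq p q) S S'' (t + t')

/-- `Steps M c c' t`: the machine `M` goes from `c` to `c'` in `t` steps. -/
def Steps {Λ σ : Type} (M : Λ → TM2.Stmt Γ Λ σ) (c c' : TM2.Cfg Γ Λ σ) (t : ℕ) : Prop :=
  (flip bind (TM2.step M))^[t] (some c) = some c'

theorem Steps.trans {Λ σ : Type} {M : Λ → TM2.Stmt Γ Λ σ} {c c' c'' : TM2.Cfg Γ Λ σ} {t t' : ℕ}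
    (h : Steps M c c' t) (h' : Steps M c' c'' t') : Steps M c c'' (t + t') := by
  unfold Steps at *
  rw [add_comm, iterate_add_apply, h, h']

theorem Steps.one {Λ σ : Type} {M : Λ → TM2.Stmt Γ Λ σ} {c c' : TM2.Cfg Γ Λ σ}
    (h : TM2.step M c = some c') : Steps M c c' 1 := h

/-- Induction on the run. The embedding `e`, the exit `x` and the memory `v` are arbitrary because a
subprogram sits inside larger code, exits to a label chosen by its context, and starts with whatever
was popped last. -/
theorem Exec.steps {Λ : Type} {M : Λ → TM2.Stmt Γ Λ (Mem Γ)} {p : StackProg Γ} {S S'} {t : ℕ}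
    (h : Exec p S S' t) : ∀ {e : p.Label → Λ} {x : Λ}, (∀ l, M (e l) = p.code e x l) → ∀ v,
      ∃ v', Steps M ⟨some (e p.entry), v, S⟩ ⟨some x, v', S'⟩ t := by
  induction h with
  | skip S =>
    intro e x hM v
    exact ⟨v, Steps.one (by rw [TM2.step, hM]; rfl)⟩
  | push S k a =>
    intro e x hM v
    exact ⟨v, Steps.one (by rw [TM2.step, hM]; rfl)⟩
  | @pop S S' k br t _ ih =>
    intro e x hM v
    obtain ⟨v', hv'⟩ := ih (e := fun l' => e (some ⟨_, l'⟩)) (x := x)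
      (fun l => hM (some ⟨_, l⟩)) (some ⟨k, (S k).head?⟩)
    refine ⟨v', ?_⟩
    rw [add_comm]
    refine (Steps.one ?_).trans hv'
    rw [TM2.step, hM]
    simp only [entry, code, TM2.stepAux]
    rw [Mem.read_some]
  | @loop_nil S k b hS =>
    intro e x hM v
    refine ⟨_, Steps.one (c' := ⟨some x, some ⟨k, none⟩, S⟩) ?_⟩
    rw [TM2.step, hM]
    simp only [entry, code, TM2.stepAux, hS, List.head?_nil, Mem.read_some, List.tail_nil]
    congr
    rw [← hS, update_eq_self]
  | @loop_cons S S' S'' k b a l t t' hS _ _ ih ih' =>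
    intro e x hM v
    -- The exit of the body is the entry of the loop itself.
    obtain ⟨v', hv'⟩ := ih (e := fun l' => e (some ⟨a, l'⟩)) (x := e none)
      (fun l => hM (some ⟨_, l⟩)) (some ⟨k, some a⟩)
    obtain ⟨v'', hv''⟩ := ih' hM v'
    refine ⟨v'', ?_⟩
    rw [add_comm]
    refine (Steps.one ?_).trans (hv'.trans hv'')
    rw [TM2.step, hM]
    simp only [entry, code, TM2.stepAux, hS, List.head?_cons, Mem.read_some, List.tail_cons]
  | @seq S S' S'' p q t t' _ _ ih ih' =>
    intro e x hM v
    obtain ⟨v', hv'⟩ := ih (e := fun l' => e (.inl l')) (x := e (.inr q.entry))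
      (fun l => hM (.inl l)) v
    obtain ⟨v'', hv''⟩ := ih' (e := fun l' => e (.inr l')) (x := x) (fun l => hM (.inr l)) v'
    exact ⟨v'', hv'.trans hv''⟩

/-- The machine that runs the program `p`. -/
noncomputable def machine [Fintype K] [∀ k, Fintype (Γ k)] (p : StackProg Γ) (k₀ k₁ : K) :
    FinTM2 where
  K := K
  k₀ := k₀
  k₁ := k₁
  Γ := Γ
  Λ := Option p.Label
  main := some p.entry
  ΛFin := have := finite_label p; Fintype.ofFinite _
  σ := Mem Γ
  initialState := none
  m
    | none => .load (fun _ => none) .halt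
    | some l => p.code some none l

/-- The additional step is the one at the label `none`: it resets the memory before halting, because
`haltList` asks for the initial state. -/
theorem outputs_machine [Fintype K] [∀ k, Fintype (Γ k)] {p : StackProg Γ} {k₀ k₁ : K} {t m : ℕ}
    {u : List (Γ k₀)} {w : List (Γ k₁)}
    (h : Exec p (update (fun _ => []) k₀ u) (update (fun _ => []) k₁ w) t) (hm : t + 1 ≤ m) :
    Nonempty (TM2OutputsInTime (p.machine k₀ k₁) u (some w) m) := by
  -- `initList` and `haltList` describe the stacks by a dependent case distinction rather than by
  -- `update`.
  have hupd : ∀ (k : K) (z : List (Γ k)) (k' : K),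
      update (β := fun k => List (Γ k)) (fun _ => []) k z k' =
        @dite (List (Γ k')) (k' = k) (inferInstance) (fun h => by rw [h]; exact z)
          fun _ => [] := by
    intro k z k'
    by_cases hk : k' = k
    · subst hk; simp
    · simp [hk]
  obtain ⟨v', hv'⟩ := h.steps (M := (p.machine k₀ k₁).m) (e := some) (x := none)
    (fun _ => rfl) none
  have h2 := hv'.trans (Steps.one (c' := ⟨none, none, update (fun _ => []) k₁ w⟩) rfl)
  have hi : initList (p.machine k₀ k₁) u =
      ⟨some (some p.entry), none, update (fun _ => []) k₀ u⟩ := by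
    unfold initList
    congr 1
    funext k
    exact (hupd k₀ u k).symm
  have ho : haltList (p.machine k₀ k₁) w = ⟨none, none, update (fun _ => []) k₁ w⟩ := by
    unfold haltList
    congr 1
    funext k
    exact (hupd k₁ w k).symm
  refine ⟨⟨⟨t + 1, ?_⟩, hm⟩⟩
  exact (congrArg (fun c => (flip bind (TM2.step (p.machine k₀ k₁).m))^[t + 1] (some c)) hi).trans
    (Eq.trans h2 (congrArg some ho.symm))

end StackProg

/-! ### Binary trees and their prefix codes -/

/-- Binary trees, the data on which the programs below work. -/
inductive BinTree
  | leaf : BinTree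
  | node (l r : BinTree) : BinTree
  deriving DecidableEq

namespace BinTree

/-- The prefix code of a tree. -/
def code : BinTree → List Bool
  | leaf => [false]
  | node a b => true :: (code a ++ code b)

/-- Prefix codes delimit themselves. The trailing words are needed in the induction, where the code
of the first subtree is followed by that of the second. -/
theorem code_append_inj {s t : BinTree} {u v : List Bool} (h : s.code ++ u = t.code ++ v) :
    s = t ∧ u = v := by
  induction s generalizing t u v with
  | leaf => cases t <;> simp_all [code]
  | node a b iha ihb =>
    cases t with
    | leaf => simp [code] at h
    | node c d =>
      simp only [code, List.cons_append, List.append_assoc, List.cons.injEq, true_and] at h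
      obtain ⟨rfl, h₁⟩ := iha h
      obtain ⟨rfl, h₂⟩ := ihb h₁
      exact ⟨rfl, h₂⟩

theorem code_injective : Function.Injective code := fun s t h =>
  (code_append_inj (u := []) (v := []) (by simpa using h)).1

theorem length_code_pos (t : BinTree) : 0 < t.code.length := by
  cases t <;> simp [code]

end BinTree

/-! ### Stack programs that move, copy and exchange coded trees -/

namespace StackProg

open Function

/-- The stacks of the machine. -/
inductive Stk
  | input | output | main | aux | buf | cnt
  deriving DecidableEq

instance : Fintype Stk :=
  ⟨{.input, .output, .main, .aux, .buf, .cnt}, fun x => by cases x <;> decide⟩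

/-- The alphabet of a stack. -/
abbrev Sym : Stk → Type
  | .input => TermToken
  | .output => Bool
  | .main => Bool
  | .aux => Bool
  | .buf => Bool
  | .cnt => Bool

instance : ∀ k, Fintype (Sym k)
  | .input => inferInstanceAs (Fintype TermToken)
  | .output => inferInstanceAs (Fintype Bool)
  | .main => inferInstanceAs (Fintype Bool)
  | .aux => inferInstanceAs (Fintype Bool)
  | .buf => inferInstanceAs (Fintype Bool)
  | .cnt => inferInstanceAs (Fintype Bool)

/-- The stacks with the given contents. -/
def st (i : List TermToken) (o m a b c : List Bool) : ∀ k, List (Sym k)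
  | .input => i
  | .output => o
  | .main => m
  | .aux => a
  | .buf => b
  | .cnt => c

section
variable (i : List TermToken) (o m a b c : List Bool)

@[simp] theorem st_input : st i o m a b c .input = i := rfl
@[simp] theorem st_output : st i o m a b c .output = o := rfl
@[simp] theorem st_main : st i o m a b c .main = m := rfl
@[simp] theorem st_aux : st i o m a b c .aux = a := rfl
@[simp] theorem st_buf : st i o m a b c .buf = b := rfl
@[simp] theorem st_cnt : st i o m a b c .cnt = c := rfl

@[simp] theorem update_input (l : List TermToken) :
    update (st i o m a b c) .input l = st l o m a b c := by funext k; cases k <;> rfl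
@[simp] theorem update_output (l : List Bool) :
    update (st i o m a b c) .output l = st i l m a b c := by funext k; cases k <;> rfl
@[simp] theorem update_main (l : List Bool) :
    update (st i o m a b c) .main l = st i o l a b c := by funext k; cases k <;> rfl
@[simp] theorem update_aux (l : List Bool) :
    update (st i o m a b c) .aux l = st i o m l b c := by funext k; cases k <;> rfl
@[simp] theorem update_buf (l : List Bool) :
    update (st i o m a b c) .buf l = st i o m a l c := by funext k; cases k <;> rfl
@[simp] theorem update_cnt (l : List Bool) :
    update (st i o m a b c) .cnt l = st i o m a b l := by funext k; cases k <;> rfl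

end

/-- `Runs p S S' T`: from the stacks `S` the program `p` ends with `S'` after at most `T` steps. -/
def Runs (p : StackProg Sym) (S S' : ∀ k, List (Sym k)) (T : ℕ) : Prop :=
  ∃ t ≤ T, Exec p S S' t

variable {p q : StackProg Sym} {S S' S'' : ∀ k, List (Sym k)} {T T' U : ℕ}

theorem Runs.mono (h : Runs p S S' T) (hT : T ≤ T') : Runs p S S' T' :=
  let ⟨t, ht, h⟩ := h
  ⟨t, ht.trans hT, h⟩

theorem Runs.mono' (h : Runs p S S' T) (hS : S' = S'') (hT : T ≤ U) : Runs p S S'' U :=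
  hS ▸ h.mono hT

theorem Runs.skip : Runs skip S S 1 := ⟨1, le_rfl, .skip S⟩

theorem Runs.push {k : Stk} {x : Sym k} (h : update S k (x :: S k) = S') :
    Runs (push k x) S S' 1 := ⟨1, le_rfl, h ▸ .push S k x⟩

theorem Runs.seq (h : Runs p S S' T) (h' : Runs q S' S'' T') :
    Runs (seq p q) S S'' (T + T') := by
  obtain ⟨t, ht, h⟩ := h
  obtain ⟨t', ht', h'⟩ := h'
  exact ⟨t + t', add_le_add ht ht', .seq h h'⟩

theorem Runs.pop {k : Stk} {br : Option (Sym k) → StackProg Sym} (S₁ : ∀ k, List (Sym k))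
    (o : Option (Sym k)) (h₁ : update S k (S k).tail = S₁) (ho : (S k).head? = o)
    (h : Runs (br o) S₁ S' T) : Runs (pop k br) S S' (T + 1) := by
  obtain ⟨t, ht, h⟩ := h
  subst h₁ ho
  exact ⟨t + 1, by omega, .pop h⟩

theorem Runs.loop_nil {k : Stk} {b : Sym k → StackProg Sym} (h : S k = []) :
    Runs (loop k b) S S 1 := ⟨1, le_rfl, .loop_nil h⟩

theorem Runs.loop_cons {k : Stk} {b : Sym k → StackProg Sym} (S₁ : ∀ k, List (Sym k))
    {x : Sym k} {l : List (Sym k)} (h : S k = x :: l) (h₁ : update S k l = S₁)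
    (hb : Runs (b x) S₁ S' T) (hl : Runs (loop k b) S' S'' T') :
    Runs (loop k b) S S'' (T + T' + 1) := by
  obtain ⟨t, ht, hb⟩ := hb
  obtain ⟨t', ht', hl⟩ := hl
  subst h₁
  exact ⟨t + t' + 1, by omega, .loop_cons h hb hl⟩

variable {i : List TermToken} {o R m a b c : List Bool}

/-- Discard the top symbol of the main stack. -/
def popMain : StackProg Sym := pop .main fun _ => skip

theorem runs_popMain {x : Bool} : Runs popMain (st i o (x :: m) a b c) (st i o m a b c) 2 :=
  .pop (st i o m a b c) (some x) (by simp) (by simp) .skip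

theorem runs_pushMain {x : Bool} :
    Runs (push .main x) (st i o m a b c) (st i o (x :: m) a b c) 1 := .push (by simp)

theorem runs_pushAux {x : Bool} :
    Runs (push .aux x) (st i o m a b c) (st i o m (x :: a) b c) 1 := .push (by simp)

theorem runs_pushBuf {x : Bool} :
    Runs (push .buf x) (st i o m a b c) (st i o m a (x :: b) c) 1 := .push (by simp)

theorem runs_pushCnt {x : Bool} :
    Runs (push .cnt x) (st i o m a b c) (st i o m a b (x :: c)) 1 := .push (by simp)

/-- Move the contents of `aux` to the main stack. -/
def auxToMain : StackProg Sym := loop .aux fun x => push .main x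

theorem runs_auxToMain :
    Runs auxToMain (st i o m a b c) (st i o (a.reverse ++ m) [] b c) (2 * a.length + 1) := by
  induction a generalizing m with
  | nil => exact .loop_nil rfl
  | cons x a ih =>
    refine (Runs.loop_cons (st i o m a b c) rfl (by simp) (runs_pushMain (x := x)) ih).mono' ?_ ?_
    · simp
    · simp; omega

/-- Move the contents of `aux` to `buf`. -/
def auxToBuf : StackProg Sym := loop .aux fun x => push .buf x

theorem runs_auxToBuf :
    Runs auxToBuf (st i o m a b c) (st i o m [] (a.reverse ++ b) c) (2 * a.length + 1) := by
  induction a generalizing b with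
  | nil => exact .loop_nil rfl
  | cons x a ih =>
    refine (Runs.loop_cons (st i o m a b c) rfl (by simp) (runs_pushBuf (x := x)) ih).mono' ?_ ?_
    · simp
    · simp; omega

/-- Move the contents of `buf` to `cnt`. -/
def bufToCnt : StackProg Sym := loop .buf fun x => push .cnt x

theorem runs_bufToCnt :
    Runs bufToCnt (st i o m a b c) (st i o m a [] (b.reverse ++ c)) (2 * b.length + 1) := by
  induction b generalizing c with
  | nil => exact .loop_nil rfl
  | cons x b ih =>
    refine (Runs.loop_cons (st i o m a b c) rfl (by simp) (runs_pushCnt (x := x)) ih).mono' ?_ ?_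
    · simp
    · simp; omega

/-- Move the contents of `cnt` to the main stack. -/
def cntToMain : StackProg Sym := loop .cnt fun x => push .main x

theorem runs_cntToMain :
    Runs cntToMain (st i o m a b c) (st i o (c.reverse ++ m) a b []) (2 * c.length + 1) := by
  induction c generalizing m with
  | nil => exact .loop_nil rfl
  | cons x c ih =>
    refine (Runs.loop_cons (st i o m a b c) rfl (by simp) (runs_pushMain (x := x)) ih).mono' ?_ ?_
    · simp
    · simp; omega

/-- Empty the stack `aux`. -/
def clearAux : StackProg Sym := loop .aux fun _ => skip

theorem runs_clearAux : Runs clearAux (st i o m a b c) (st i o m [] b c) (2 * a.length + 1) := by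
  induction a with
  | nil => exact .loop_nil rfl
  | cons x a ih =>
    refine (Runs.loop_cons (st i o m a b c) rfl (by simp) .skip ih).mono ?_
    simp; omega

/-- Move the contents of `aux` to the main stack and to `buf`. -/
def auxToBoth : StackProg Sym := loop .aux fun x => seq (push .main x) (push .buf x)

theorem runs_auxToBoth :
    Runs auxToBoth (st i o m a b c) (st i o (a.reverse ++ m) [] (a.reverse ++ b) c)
      (3 * a.length + 1) := by
  induction a generalizing m b with
  | nil => exact .loop_nil rfl
  | cons x a ih =>
    refine (Runs.loop_cons (st i o m a b c) rfl (by simp)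
      ((runs_pushMain (x := x)).seq runs_pushBuf)
      ih).mono' ?_ ?_
    · simp
    · simp; omega

/-- Treat one symbol of a tree that is moved from the main stack to `aux`; the height of `cnt`
is the number of subtrees that are still to be moved. -/
def shiftSymbol : Option Bool → StackProg Sym
  | none => skip
  | some false => push .aux false
  | some true => seq (push .aux true) (seq (push .cnt true) (push .cnt true))

/-- Move as many trees from the main stack to `aux` as `cnt` is high. -/
def shiftTrees : StackProg Sym := loop .cnt fun _ => pop .main shiftSymbol

/-- The remaining run is a hypothesis, so that at a node the induction hypotheses for the two
subtrees can be chained. A leaf lowers `cnt` by one and a node raises it by one, so the loop has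
used up its unit of `cnt` exactly at the end of the code. -/
theorem runs_shiftTrees (t : BinTree)
    (h : Runs shiftTrees (st i o m (t.code.reverse ++ a) b c) S' T) :
    Runs shiftTrees (st i o (t.code ++ m) a b (true :: c)) S' (T + 5 * t.code.length) := by
  induction t generalizing m a c T with
  | leaf =>
    refine (Runs.loop_cons (st i o (false :: m) a b c) rfl (by simp; rfl)
      (.pop (st i o m a b c) (some false) (by simp) (by simp)
        runs_pushAux) h).mono ?_
    simp [BinTree.code]; omega
  | node l r ihl ihr =>
    have h₁ := ihl (a := true :: a) (c := true :: c) (m := r.code ++ m)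
      (ihr (by simpa [BinTree.code] using h))
    refine (Runs.loop_cons (st i o (true :: (l.code ++ (r.code ++ m))) a b c) rfl
      (by simp [BinTree.code])
      (.pop (st i o (l.code ++ (r.code ++ m)) a b c) (some true) (by simp) (by simp)
        (runs_pushAux.seq (runs_pushCnt.seq runs_pushCnt))) h₁).mono ?_
    simp [BinTree.code]; omega

/-- Move the tree on top of the main stack to `aux`. -/
def moveTree : StackProg Sym := seq (push .cnt true) shiftTrees

theorem runs_moveTree (t : BinTree) :
    Runs moveTree (st i o (t.code ++ m) a b []) (st i o m (t.code.reverse ++ a) b [])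
      (5 * t.code.length + 2) :=
  (runs_pushCnt.seq (runs_shiftTrees t (.loop_nil rfl))).mono (by omega)

/-- Discard the tree on top of the main stack. -/
def dropTree : StackProg Sym := seq moveTree clearAux

theorem runs_dropTree (t : BinTree) :
    Runs dropTree (st i o (t.code ++ m) [] b []) (st i o m [] b []) (7 * t.code.length + 3) :=
  ((runs_moveTree t).seq runs_clearAux).mono (by simp; omega)

/-- Copy the tree on top of the main stack. -/
def dupTree : StackProg Sym := seq moveTree (seq auxToBoth (seq bufToCnt cntToMain))

theorem runs_dupTree (t : BinTree) :
    Runs dupTree (st i o (t.code ++ m) [] [] []) (st i o (t.code ++ (t.code ++ m)) [] [] [])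
      (12 * t.code.length + 5) :=
  ((runs_moveTree t).seq (runs_auxToBoth.seq (runs_bufToCnt.seq runs_cntToMain))).mono'
    (by simp) (by simp; omega)

/-- Exchange the two trees on top of the main stack. -/
def swapTrees : StackProg Sym :=
  seq moveTree (seq auxToBuf (seq moveTree (seq bufToCnt (seq cntToMain auxToMain))))

/-- The first tree waits in `buf`, since `moveTree` needs `aux` and `cnt` for the second one. Its
way back through `cnt` restores the order of its symbols. -/
theorem runs_swapTrees (s t : BinTree) :
    Runs swapTrees (st i o (s.code ++ (t.code ++ m)) [] [] [])
      (st i o (t.code ++ (s.code ++ m)) [] [] [])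
      (11 * s.code.length + 7 * t.code.length + 8) :=
  ((runs_moveTree s).seq (runs_auxToBuf.seq ((runs_moveTree t).seq
    (runs_bufToCnt.seq (runs_cntToMain.seq runs_auxToMain))))).mono' (by simp) (by simp; omega)

/-- The list with the given entries, as a tree. -/
def _root_.BinTree.ofList : List BinTree → BinTree
  | [] => .leaf
  | t :: l => .node t (ofList l)

/-- A truth value, as a tree. -/
def _root_.BinTree.ofBool : Bool → BinTree
  | true => .node .leaf .leaf
  | false => .leaf

/-- Push the code of a truth value on the main stack. -/
def pushBool : Bool → StackProg Sym
  | true => seq (push .main false) (seq (push .main false) (push .main true))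
  | false => push .main false

theorem runs_pushBool (x : Bool) :
    Runs (pushBool x) (st i o m a b c) (st i o ((BinTree.ofBool x).code ++ m) a b c) 3 := by
  cases x
  · exact runs_pushMain.mono (by omega)
  · exact runs_pushMain.seq (runs_pushMain.seq runs_pushMain)

/-- Turn the contents of `aux` into a list of truth values. -/
def auxToList : StackProg Sym := loop .aux fun x => seq (pushBool x) (push .main true)

theorem runs_auxToList (l : List Bool) :
    Runs auxToList (st i o ((BinTree.ofList (l.map BinTree.ofBool)).code ++ m) a b c)
      (st i o ((BinTree.ofList ((a.reverse ++ l).map BinTree.ofBool)).code ++ m) [] b c)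
      (5 * a.length + 1) := by
  induction a generalizing l with
  | nil => exact .loop_nil rfl
  | cons x a ih =>
    have h := ih (x :: l)
    simp only [List.map_cons, BinTree.ofList, BinTree.code, List.cons_append,
      List.append_assoc] at h
    refine (Runs.loop_cons (st i o _ a b c) rfl (by simp)
      ((runs_pushBool x).seq runs_pushMain) h).mono' ?_ ?_
    · simp
    · simp; omega

/-- Replace the tree on top of the main stack by the list of the symbols of its code. -/
def spellTree : StackProg Sym := seq moveTree (seq (push .main false) auxToList)

theorem runs_spellTree (t : BinTree) :
    Runs spellTree (st i o (t.code ++ m) [] b [])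
      (st i o ((BinTree.ofList (t.code.map BinTree.ofBool)).code ++ m) [] b [])
      (10 * t.code.length + 4) :=
  ((runs_moveTree t).seq (runs_pushMain.seq (runs_auxToList []))).mono' (by simp)
    (by simp; omega)

end StackProg

/-! ### Polynomial-time functions on data coded by trees -/

open StackProg Polynomial

/-- A step pushes at most one symbol, so the running time controls the size of the result. -/
theorem StackProg.Exec.sum_length_le {K : Type} {Γ : K → Type} [DecidableEq K] [Fintype K]
    {p : StackProg Γ} {S S' : ∀ k, List (Γ k)} {t : ℕ} (h : Exec p S S' t) :
    ∑ k, (S' k).length ≤ ∑ k, (S k).length + t := by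
  have key : ∀ (S : ∀ k, List (Γ k)) k (l : List (Γ k)) (m : ℕ), l.length ≤ (S k).length + m →
      ∑ k', (Function.update S k l k').length ≤ ∑ k', (S k').length + m := by
    intro S k l m hl
    have h₁ : ∀ k', (Function.update S k l k').length ≤
        (S k').length + if k' = k then m else 0 := by
      intro k'
      by_cases hk : k' = k
      · subst hk; simpa using hl
      · simp [hk]
    refine (Finset.sum_le_sum fun k' _ => h₁ k').trans ?_
    simp [Finset.sum_add_distrib]
  induction h with
  | skip S => omega
  | push S k a => exact key S k _ 1 (by simp)
  | @pop S S' k br t _ ih => have := key S k (S k).tail 0 (by simp); omega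
  | loop_nil _ => omega
  | @loop_cons S S' S'' k b a l t t' hS _ _ ih ih' =>
    have := key S k l 0 (by simp [hS]); omega
  | seq _ _ ih ih' => omega

/-- Types whose elements are represented by binary trees. -/
class TreeRep (α : Type) where
  rep : α → BinTree
  rep_injective : Function.Injective rep

open TreeRep (rep)

/-- The size of the representation of `x`. -/
def sz {α : Type} [TreeRep α] (x : α) : ℕ := (rep x).code.length

instance : TreeRep BinTree := ⟨id, Function.injective_id⟩

instance : TreeRep Unit := ⟨fun _ => .leaf, fun _ _ _ => rfl⟩

instance : TreeRep Bool := ⟨BinTree.ofBool, fun a b => by cases a <;> cases b <;> simp [BinTree.ofBool]⟩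

/-- A natural number in unary, as a tree. -/
def BinTree.ofNat : ℕ → BinTree
  | 0 => .leaf
  | n + 1 => .node .leaf (ofNat n)

instance : TreeRep ℕ := ⟨BinTree.ofNat, fun m n h => by
  induction m generalizing n with
  | zero => cases n with
    | zero => rfl
    | succ n => simp [BinTree.ofNat] at h
  | succ m ih => cases n with
    | zero => simp [BinTree.ofNat] at h
    | succ n => rw [ih n (BinTree.node.inj h).2]⟩

instance {α β : Type} [TreeRep α] [TreeRep β] : TreeRep (α × β) :=
  ⟨fun p => .node (rep p.1) (rep p.2), fun p q h => by
    simp only [BinTree.node.injEq] at h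
    exact Prod.ext (TreeRep.rep_injective h.1) (TreeRep.rep_injective h.2)⟩

theorem BinTree.ofList_injective : Function.Injective BinTree.ofList := fun l m h => by
  induction l generalizing m with
  | nil => cases m with
    | nil => rfl
    | cons b m => simp [BinTree.ofList] at h
  | cons a l ih => cases m with
    | nil => simp [BinTree.ofList] at h
    | cons b m => rw [(BinTree.node.inj h).1, ih _ (BinTree.node.inj h).2]

instance {α : Type} [TreeRep α] : TreeRep (List α) :=
  ⟨fun l => .ofList (l.map rep),
    BinTree.ofList_injective.comp (List.map_injective_iff.2 TreeRep.rep_injective)⟩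

instance {α : Type} [TreeRep α] : TreeRep (Option α) :=
  ⟨fun o => o.elim .leaf fun a => .node .leaf (rep a), fun a b h => by
    cases a <;> cases b <;> simp_all
    exact TreeRep.rep_injective h⟩

section

variable {α β γ δ ε : Type} [TreeRep α] [TreeRep β] [TreeRep γ] [TreeRep δ] [TreeRep ε]

theorem rep_bool (b : Bool) : rep b = BinTree.ofBool b := rfl
theorem rep_pair (a : α) (b : β) : rep (a, b) = .node (rep a) (rep b) := rfl
theorem rep_nil : rep ([] : List α) = .leaf := rfl
theorem rep_cons (a : α) (l : List α) : rep (a :: l) = .node (rep a) (rep l) := rfl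
theorem rep_none : rep (none : Option α) = .leaf := rfl
theorem rep_some (a : α) : rep (some a) = .node .leaf (rep a) := rfl
theorem rep_zero : rep 0 = .leaf := rfl
theorem rep_succ (n : ℕ) : rep (n + 1) = .node .leaf (rep n) := rfl

theorem sz_pos (a : α) : 0 < sz a := BinTree.length_code_pos _

@[simp] theorem sz_pair (a : α) (b : β) : sz (a, b) = sz a + sz b + 1 := by
  simp [sz, rep_pair, BinTree.code]

@[simp] theorem sz_nil : sz ([] : List α) = 1 := rfl

@[simp] theorem sz_cons (a : α) (l : List α) : sz (a :: l) = sz a + sz l + 1 := by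
  simp [sz, rep_cons, BinTree.code]

@[simp] theorem sz_none : sz (none : Option α) = 1 := rfl

@[simp] theorem sz_some (a : α) : sz (some a) = sz a + 2 := by
  simp [sz, rep_some, BinTree.code]

@[simp] theorem sz_nat (n : ℕ) : sz n = 2 * n + 1 := by
  induction n with
  | zero => rfl
  | succ n ih =>
    have : sz (n + 1) = sz n + 2 := by simp [sz, rep_succ, BinTree.code]
    omega

theorem sz_bool_le (b : Bool) : sz b ≤ 3 := by cases b <;> decide

@[simp] theorem sz_leaf : sz BinTree.leaf = 1 := rfl

@[simp] theorem sz_node (a b : BinTree) : sz (BinTree.node a b) = sz a + sz b + 1 := by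
  simp only [sz, rep, BinTree.code, id, List.length_cons, List.length_append]

/-- `F` is bounded by a polynomial in the size of its argument. -/
@[fun_prop]
def PolyBounded (F : α → ℕ) : Prop := ∃ q : Polynomial ℕ, ∀ x, F x ≤ q.eval (sz x)

theorem Polynomial.eval_mono_nat (q : Polynomial ℕ) {m n : ℕ} (h : m ≤ n) :
    q.eval m ≤ q.eval n := by
  rw [eval_eq_sum, eval_eq_sum]
  exact Finset.sum_le_sum fun i _ => Nat.mul_le_mul_left _ (Nat.pow_le_pow_left h i)

theorem PolyBounded.mono {F G : α → ℕ} (hG : PolyBounded G) (h : ∀ x, F x ≤ G x) :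
    PolyBounded F :=
  let ⟨q, hq⟩ := hG
  ⟨q, fun x => (h x).trans (hq x)⟩

@[fun_prop]
theorem PolyBounded.const (c : ℕ) : PolyBounded fun _ : α => c := ⟨C c, by simp⟩

@[fun_prop]
theorem PolyBounded.add {F G : α → ℕ} (hF : PolyBounded F) (hG : PolyBounded G) :
    PolyBounded fun x => F x + G x := by
  obtain ⟨p, hp⟩ := hF
  obtain ⟨q, hq⟩ := hG
  exact ⟨p + q, fun x => by rw [eval_add]; exact add_le_add (hp x) (hq x)⟩

@[fun_prop]
theorem PolyBounded.mul {F G : α → ℕ} (hF : PolyBounded F) (hG : PolyBounded G) :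
    PolyBounded fun x => F x * G x := by
  obtain ⟨p, hp⟩ := hF
  obtain ⟨q, hq⟩ := hG
  exact ⟨p * q, fun x => by rw [eval_mul]; exact Nat.mul_le_mul (hp x) (hq x)⟩

theorem PolyBounded.self : PolyBounded fun x : α => sz x := ⟨X, by simp⟩

theorem PolyBounded.eval {F : α → ℕ} (hF : PolyBounded F) (q : Polynomial ℕ) :
    PolyBounded fun x => q.eval (F x) := by
  obtain ⟨p, hp⟩ := hF
  exact ⟨q.comp p, fun x => by rw [eval_comp]; exact q.eval_mono_nat (hp x)⟩

/-- `f` is computed in polynomial time by a program that replaces the argument on top of the main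
stack by the value. -/
@[fun_prop]
def PT (f : α → β) : Prop :=
  ∃ (p : StackProg Sym) (T : α → ℕ), PolyBounded T ∧ ∀ x m,
    Runs p (st [] [] ((rep x).code ++ m) [] [] []) (st [] [] ((rep (f x)).code ++ m) [] [] []) (T x)

/-- This makes composition work: a time bound polynomial in the size of `f x` becomes polynomial in
the size of `x`. -/
theorem PT.polyBounded_sz {f : α → β} (hf : PT f) : PolyBounded fun x => sz (f x) := by
  obtain ⟨p, T, hT, h⟩ := hf
  refine PolyBounded.mono (PolyBounded.self.add hT) fun x => ?_
  obtain ⟨t, ht, h⟩ := h x []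
  have := h.sum_length_le
  have key : ∀ m, ∑ k, (st [] [] m [] [] [] k).length = m.length := by
    intro m
    rw [Finset.sum_eq_single Stk.main] <;> simp
    intro k; cases k <;> simp
  rw [key, key] at this
  simp only [List.append_nil] at this
  simp only [sz]
  omega

theorem PolyBounded.comp {F : β → ℕ} {f : α → β} (hF : PolyBounded F) (hf : PT f) :
    PolyBounded fun x => F (f x) := by
  obtain ⟨q, hq⟩ := hF
  exact (hf.polyBounded_sz.eval q).mono fun x => hq _

@[fun_prop]
theorem PolyBounded.size {f : α → β} (hf : PT f) : PolyBounded fun x => sz (f x) :=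
  hf.polyBounded_sz

theorem PT.cast {f : α → β} (h : ∀ x, rep (f x) = rep x) : PT f :=
  ⟨.skip, fun _ => 1, .const 1, fun x m => by rw [h]; exact .skip⟩

@[fun_prop]
theorem PT.id' : PT fun x : α => x := .cast fun _ => rfl

@[fun_prop]
theorem PT.comp {g : β → γ} {f : α → β} (hg : PT g) (hf : PT f) : PT fun x => g (f x) := by
  obtain ⟨q, U, hU, hg⟩ := hg
  obtain ⟨p, T, hT, hf'⟩ := hf
  exact ⟨.seq p q, fun x => T x + U (f x), hT.add (hU.comp ⟨p, T, hT, hf'⟩),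
    fun x m => (hf' x m).seq (hg (f x) m)⟩

@[fun_prop]
theorem PT.prodMk {f : α → β} {g : α → γ} (hf : PT f) (hg : PT g) : PT fun x => (f x, g x) := by
  have hg₀ := hg
  obtain ⟨p, T, hT, hf⟩ := hf
  obtain ⟨q, U, hU, hg⟩ := hg
  -- The value of `g` comes first because `f x` has to end on top: the code of a pair is `true`,
  -- then the code of the first component, then that of the second.
  refine ⟨.seq dupTree (.seq q (.seq swapTrees (.seq p (.push .main true)))),
    fun x => 12 * sz x + 5 + (U x + (11 * sz (g x) + 7 * sz x + 8 + (T x + 1))), ?_,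
    fun x m => ?_⟩
  · have := hg₀.polyBounded_sz
    have h := PolyBounded.self (α := α)
    fun_prop
  · exact ((runs_dupTree _).seq ((hg x _).seq ((runs_swapTrees _ _).seq
      ((hf x _).seq runs_pushMain)))).mono' (by simp [rep_pair, BinTree.code]) le_rfl

/-- The common source of all case distinctions. Types such as lists, options, numbers and truth
values represent their empty constructor by a leaf and the other one by a node, so a single popped
symbol tells the cases apart. The node is reread as a value `y` of another type with the same tree.
-/
theorem PT.split {u : γ → δ} {f : γ → β} {g : ε × γ → β} {P : γ → β} (hu : PT u) (hf : PT f)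
    (hg : PT g) (h : ∀ x, (rep (u x) = .leaf ∧ P x = f x) ∨
      ∃ y, rep (u x) ≠ .leaf ∧ rep (u x) = rep y ∧ P x = g (y, x)) : PT P := by
  have hu₀ := hu.polyBounded_sz
  obtain ⟨r, V, hV, hu⟩ := hu
  obtain ⟨p, T, hT, hf⟩ := hf
  obtain ⟨q, U, hU, hg⟩ := hg
  obtain ⟨U', hU'⟩ := hU
  let br : Option Bool → StackProg Sym
    | none => .skip
    | some false => p
    -- One `true` restores the symbol just popped; the other pairs the restored tree with the copy
    -- of `x` below it.
    | some true => .seq (.push .main true) (.seq (.push .main true) q)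
  refine ⟨.seq dupTree (.seq r (.pop .main br)),
    fun x => 12 * sz x + 5 + (V x + (T x + (2 + U'.eval (sz (u x) + sz x + 1)) + 1)), ?_,
    fun x m => ?_⟩
  · have h := PolyBounded.self (α := γ)
    have := ((hu₀.add h).add (.const 1)).eval U'
    fun_prop
  · refine (runs_dupTree _).seq ((hu x _).seq ?_)
    obtain ⟨h₁, h₂⟩ | ⟨y, h₁, h₂, h₃⟩ := h x
    · rw [h₁, h₂]
      exact (Runs.pop (st [] [] ((rep x).code ++ m) [] [] []) (some false)
        (by simp [BinTree.code]) (by simp [BinTree.code]) (hf x m)).mono (by omega)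
    · rw [h₃]
      have hsz : U (y, x) ≤ U'.eval (sz (u x) + sz x + 1) := by
        refine (hU' (y, x)).trans (le_of_eq ?_)
        rw [sz_pair, show sz y = sz (u x) by unfold sz; rw [h₂]]
      rcases hd : rep (u x) with _ | ⟨a, b⟩
      · exact absurd hd h₁
      · refine (Runs.pop (st [] [] ((a.code ++ b.code) ++ ((rep x).code ++ m)) [] [] [])
          (some true) (by simp [BinTree.code]) (by simp [BinTree.code])
          (runs_pushMain.seq (runs_pushMain.seq (hg (y, x) m |>.mono hsz |> fun h => ?_)))).mono
          (T := 1 + (1 + U'.eval (sz (u x) + sz x + 1)) + 1) (by omega)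
        simpa [rep_pair, ← h₂, hd, BinTree.code] using h

/-- One round of `iterate`: decrease the counter on top of the main stack and apply `p` to the
value below it. -/
def iterateRound (p : StackProg Sym) : Option Bool → StackProg Sym
  | none => .skip
  | some false => .skip
  | some true =>
    .seq popMain (.seq swapTrees (.seq p (.seq swapTrees (.push .cnt true))))

/-- The single symbol on `cnt` is a flag that keeps the loop alive; a round renews it unless the
counter has reached zero. In the bound, `36 * n + 18 * B` pays for the two exchanges of counter and
value. -/
theorem PT.iterate_aux {f : α → α} (hf : PT f) : ∃ q : Polynomial ℕ, ∃ p, ∀ B (n : ℕ) x m,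
    (∀ k ≤ n, sz (f^[k] x) ≤ B) →
    Runs (.loop .cnt fun _ => .pop .main (iterateRound p))
      (st [] [] ((rep n).code ++ ((rep x).code ++ m)) [] [] [true])
      (st [] [] ((rep (f^[n] x)).code ++ m) [] [] [])
      ((n + 1) * (q.eval B + 36 * n + 18 * B + 40)) := by
  obtain ⟨p, T, ⟨q, hq⟩, h⟩ := hf
  refine ⟨q, p, fun B n x m hB => ?_⟩
  induction n generalizing x with
  | zero =>
    exact (Runs.loop_cons (st [] [] (false :: ((rep x).code ++ m)) [] [] []) rfl
      (by simp; rfl) (.pop (st [] [] ((rep x).code ++ m) [] [] []) (some false) (by simp)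
      (by simp) .skip) (.loop_nil rfl)).mono (by omega)
  | succ n ih =>
    have h₁ := ih (f x) fun k hk => by
      rw [← Function.iterate_succ_apply]; exact hB _ (by omega)
    rw [Function.iterate_succ_apply]
    refine (Runs.loop_cons (st [] [] ((rep (n + 1)).code ++ ((rep x).code ++ m)) [] [] []) rfl
      (by simp) (.pop (st [] [] (false :: ((rep n).code ++ ((rep x).code ++ m))) [] [] [])
        (some true) (by simp [rep_succ, BinTree.code]) (by simp [rep_succ, BinTree.code])
        (runs_popMain.seq ((runs_swapTrees _ _).seq ((h x _).seq ((runs_swapTrees _ _).seq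
          runs_pushCnt))))) h₁).mono ?_
    have e₁ : (rep n).code.length = 2 * n + 1 := sz_nat n
    have e₂ : (rep x).code.length ≤ B := hB 0 (by omega)
    have e₃ : (rep (f x)).code.length ≤ B := hB 1 (by omega)
    have e₄ : T x ≤ q.eval B := (hq x).trans (q.eval_mono_nat e₂)
    have e₅ : (n + 1) * (q.eval B + 36 * n + 18 * B + 40) ≤
      (n + 1) * (q.eval B + 36 * (n + 1) + 18 * B + 40) := Nat.mul_le_mul_left _ (by omega)
    have e₆ : (n + 1 + 1) * (q.eval B + 36 * (n + 1) + 18 * B + 40) =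
      (n + 1) * (q.eval B + 36 * (n + 1) + 18 * B + 40) +
        (q.eval B + 36 * (n + 1) + 18 * B + 40) := by ring
    omega

/-- Iterating a polynomial-time function can produce exponentially large values; hence the required
bound on all intermediate results. -/
theorem PT.iterate_const {f : α → α} {n : γ → ℕ} {b : γ → α} {B : γ → ℕ} (hf : PT f) (hn : PT n)
    (hb : PT b) (hB : PolyBounded B) (h : ∀ x, ∀ k ≤ n x, sz (f^[k] (b x)) ≤ B x) :
    PT fun x => f^[n x] (b x) := by
  obtain ⟨q, p, hp⟩ := hf.iterate_aux
  have hnb := hn.prodMk hb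
  have hn := hn.polyBounded_sz
  obtain ⟨r, V, hV, hr⟩ := hnb
  refine ⟨.seq r (.seq popMain (.seq (.push .cnt true)
    (.loop .cnt fun _ => .pop .main (iterateRound p)))),
    fun x => V x + (2 + (1 + (sz (n x) + 1) * (q.eval (B x) + 36 * sz (n x) + 18 * B x + 40))),
    ?_, fun x m => ?_⟩
  · have := hB.eval q
    fun_prop
  · refine ((hr x m).seq (Runs.seq (S' := st [] [] ((rep (n x)).code ++
      ((rep (b x)).code ++ m)) [] [] []) (T := 2) ?_
      (runs_pushCnt.seq (hp (B x) (n x) (b x) m (h x))))).mono ?_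
    · simpa [rep_pair, BinTree.code] using runs_popMain
    · have : n x ≤ sz (n x) := by rw [sz_nat]; omega
      dsimp only
      gcongr

end

/-! ### A library of polynomial-time operations -/

section

variable {α β γ δ ε : Type} [TreeRep α] [TreeRep β] [TreeRep γ] [TreeRep δ] [TreeRep ε]

theorem PT.congr {f g : α → β} (hf : PT f) (h : ∀ x, f x = g x) : PT g := funext h ▸ hf

theorem PT.rep {f : α → β} (hf : PT f) : PT fun x => rep (f x) := hf

theorem PT.of_rep {f : α → β} (hf : PT fun x => TreeRep.rep (f x)) : PT f := hf

theorem PT.const_tree (t : BinTree) : PT fun _ : α => t := by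
  induction t with
  | leaf =>
    refine ⟨.seq dropTree (.push .main false), fun x => 7 * sz x + 3 + 1, ?_, fun x m =>
      (runs_dropTree _).seq runs_pushMain⟩
    have := PolyBounded.self (α := α)
    fun_prop
  | node a b iha ihb => exact (iha.prodMk ihb).rep

@[fun_prop]
theorem PT.const (c : β) : PT fun _ : α => c := .of_rep (.const_tree _)

theorem PT.fst' : PT fun p : α × β => p.1 := by
  refine ⟨.seq popMain (.seq swapTrees dropTree), fun p => 2 + ((11 * sz p + 7 * sz p + 8) +
    (7 * sz p + 3)), ?_, fun x m => ?_⟩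
  · have := PolyBounded.self (α := α × β)
    fun_prop
  · obtain ⟨x, y⟩ := x
    have h := (runs_popMain (i := []) (o := []) (a := []) (b := []) (c := []) (x := true)).seq
      ((runs_swapTrees (TreeRep.rep x) (TreeRep.rep y) (m := m)).seq (runs_dropTree _))
    refine Runs.mono' (by simpa [rep_pair, BinTree.code] using h) rfl ?_
    dsimp only
    rw [sz_pair]
    simp only [sz]
    omega

theorem PT.snd' : PT fun p : α × β => p.2 := by
  refine ⟨.seq popMain dropTree, fun p => 2 + (7 * sz p + 3), ?_, fun x m => ?_⟩
  · have := PolyBounded.self (α := α × β)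
    fun_prop
  · obtain ⟨x, y⟩ := x
    have h := (runs_popMain (i := []) (o := []) (a := []) (b := []) (c := []) (x := true)).seq
      (runs_dropTree (TreeRep.rep x) (m := (TreeRep.rep y).code ++ m))
    refine Runs.mono' (by simpa [rep_pair, BinTree.code] using h) rfl ?_
    dsimp only
    rw [sz_pair]
    simp only [sz]
    omega

@[fun_prop]
theorem PT.fst {f : γ → α × β} (hf : PT f) : PT fun x => (f x).1 := PT.fst'.comp hf

@[fun_prop]
theorem PT.snd {f : γ → α × β} (hf : PT f) : PT fun x => (f x).2 := PT.snd'.comp hf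

@[fun_prop]
theorem PT.node {f g : γ → BinTree} (hf : PT f) (hg : PT g) : PT fun x => BinTree.node (f x) (g x) :=
  (hf.prodMk hg).rep

@[fun_prop]
theorem PT.cons {f : γ → α} {l : γ → List α} (hf : PT f) (hl : PT l) : PT fun x => f x :: l x :=
  .of_rep (hf.prodMk hl).rep

@[fun_prop]
theorem PT.optionSome {f : γ → α} (hf : PT f) : PT fun x => some (f x) :=
  .of_rep ((PT.const ()).prodMk hf).rep

@[fun_prop]
theorem PT.succ {f : γ → ℕ} (hf : PT f) : PT fun x => f x + 1 :=
  .of_rep ((PT.const ()).prodMk hf).rep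

-- Turning a tree into the word of its code reduces recursion on trees to folds over lists; equality
-- of trees and the list of subtrees are obtained in this way.
@[fun_prop]
theorem PT.spell {f : γ → BinTree} (hf : PT f) : PT fun x => (f x).code := by
  refine PT.comp (g := BinTree.code) ⟨spellTree, fun t => 10 * sz t + 4, ?_, fun t m =>
    runs_spellTree t⟩ hf
  have := PolyBounded.self (α := BinTree)
  fun_prop

@[fun_prop]
theorem PT.cond {c : γ → Bool} {f g : γ → β} (hc : PT c) (hf : PT f) (hg : PT g) :
    PT fun x => bif c x then f x else g x := by
  refine PT.split (ε := Unit × Unit) hc hg (hf.comp PT.snd') fun x => ?_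
  cases h : c x
  · exact .inl ⟨rfl, by simp⟩
  · exact .inr ⟨((), ()), nofun, rfl, by simp⟩

theorem PT.listCases {l : γ → List α} {f : γ → β} {g : γ → α → List α → β} (hl : PT l) (hf : PT f)
    (hg : PT fun p : (α × List α) × γ => g p.2 p.1.1 p.1.2) :
    PT fun x => match l x with
      | [] => f x
      | a :: t => g x a t := by
  refine PT.split hl hf hg fun x => ?_
  rcases h : l x with _ | ⟨a, t⟩
  · exact .inl ⟨rfl, by simp⟩
  · exact .inr ⟨(a, t), nofun, rfl, by simp⟩

theorem PT.optionCases {l : γ → Option α} {f : γ → β} {g : γ → α → β} (hl : PT l) (hf : PT f)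
    (hg : PT fun p : γ × α => g p.1 p.2) :
    PT fun x => match l x with
      | none => f x
      | some a => g x a := by
  refine PT.split (ε := Unit × α) (g := fun p => g p.2 p.1.2) hl hf
    (hg.comp (f := fun p : (Unit × α) × γ => (p.2, p.1.2)) (by fun_prop)) fun x => ?_
  rcases h : l x with _ | a
  · exact .inl ⟨rfl, by simp⟩
  · exact .inr ⟨((), a), nofun, rfl, by simp⟩

theorem PT.natCases {n : γ → ℕ} {f : γ → β} {g : γ → ℕ → β} (hn : PT n) (hf : PT f)
    (hg : PT fun p : γ × ℕ => g p.1 p.2) :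
    PT fun x => match n x with
      | 0 => f x
      | k + 1 => g x k := by
  refine PT.split (ε := Unit × ℕ) (g := fun p => g p.2 p.1.2) hn hf
    (hg.comp (f := fun p : (Unit × ℕ) × γ => (p.2, p.1.2)) (by fun_prop)) fun x => ?_
  rcases h : n x with _ | a
  · exact .inl ⟨rfl, by simp⟩
  · exact .inr ⟨((), a), nofun, rfl, by simp⟩

theorem PT.treeCases {t : γ → BinTree} {f : γ → β} {g : γ → BinTree → BinTree → β} (ht : PT t)
    (hf : PT f) (hg : PT fun p : (BinTree × BinTree) × γ => g p.2 p.1.1 p.1.2) :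
    PT fun x => match t x with
      | .leaf => f x
      | .node a b => g x a b := by
  refine PT.split ht hf hg fun x => ?_
  rcases h : t x with _ | ⟨a, b⟩
  · exact .inl ⟨rfl, by simp⟩
  · exact .inr ⟨(a, b), nofun, rfl, by simp⟩

/-- Turn the height of `aux` into a number. -/
def auxToNat : StackProg Sym := loop .aux fun _ => seq (push .main false) (push .main true)

theorem runs_auxToNat {a b c m : List Bool} (n : ℕ) :
    Runs auxToNat (st [] [] ((TreeRep.rep n).code ++ m) a b c)
      (st [] [] ((TreeRep.rep (a.length + n)).code ++ m) [] b c) (3 * a.length + 1) := by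
  induction a generalizing n with
  | nil =>
    rw [List.length_nil, Nat.zero_add]
    exact .loop_nil rfl
  | cons x a ih =>
    have h := ih (n + 1)
    rw [rep_succ] at h
    simp only [BinTree.code, List.cons_append, List.nil_append] at h
    refine (Runs.loop_cons (st [] [] _ a b c) rfl (by simp) (runs_pushMain.seq runs_pushMain)
      h).mono' ?_ ?_
    · rw [List.length_cons, Nat.add_right_comm, Nat.add_assoc]
    · simp; omega

@[fun_prop]
theorem PT.size {f : γ → α} (hf : PT f) : PT fun x => sz (f x) := by
  refine PT.comp (g := fun a : α => sz a) ⟨seq moveTree (seq (push .main false) auxToNat),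
    fun t => 5 * sz t + 2 + (1 + (3 * sz t + 1)), ?_, fun t m => ?_⟩ hf
  · have := PolyBounded.self (α := α)
    fun_prop
  · refine ((runs_moveTree _).seq (runs_pushMain.seq (runs_auxToNat 0))).mono' ?_ ?_
    · simp [sz]
    · simp [sz]

theorem sz_le_of_mem {a : α} {l : List α} (h : a ∈ l) : sz a ≤ sz l := by
  induction l with
  | nil => simp at h
  | cons b l ih =>
    rw [sz_cons]
    rcases List.mem_cons.1 h with rfl | h
    · omega
    · have := ih h; omega

theorem sz_append (l m : List α) : sz (l ++ m) + 1 = sz l + sz m := by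
  induction l with
  | nil => simp; omega
  | cons a l ih => simp; omega

theorem length_lt_sz (l : List α) : l.length < sz l := by
  induction l with
  | nil => simp
  | cons a l ih => simp; omega

theorem sz_drop_le (l : List α) (k : ℕ) : sz (l.drop k) ≤ sz l := by
  have := sz_append (l.take k) (l.drop k)
  rw [List.take_append_drop] at this
  have := sz_pos (l.take k)
  omega

/-- The parameter `x` travels along as a constant component of the iterated state. -/
theorem PT.iterate {f : γ → α → α} {n : γ → ℕ} {b : γ → α} {B : γ → ℕ}
    (hf : PT fun p : γ × α => f p.1 p.2) (hn : PT n) (hb : PT b) (hB : PolyBounded B)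
    (h : ∀ x, ∀ k ≤ n x, sz ((f x)^[k] (b x)) ≤ B x) : PT fun x => (f x)^[n x] (b x) := by
  have key : ∀ x k, (fun p : γ × α => (p.1, f p.1 p.2))^[k] (x, b x) = (x, (f x)^[k] (b x)) := by
    intro x k
    induction k with
    | zero => rfl
    | succ k ih => rw [Function.iterate_succ_apply', ih, Function.iterate_succ_apply']
  have h₁ : PT fun x => ((fun p : γ × α => (p.1, f p.1 p.2))^[n x] (x, b x)).2 := by
    refine PT.snd (PT.iterate_const (B := fun x => sz x + B x + 1) (PT.fst'.prodMk hf) hn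
      (PT.id'.prodMk hb) ?_ fun x k hk => ?_)
    · have := PolyBounded.self (α := γ)
      fun_prop
    · rw [key, sz_pair]
      have := h x k hk
      omega
  simpa only [key] using h₁

/-- A fold is an iteration on pairs of an accumulator and the part of the list not yet read. -/
theorem PT.foldl {l : γ → List α} {b : γ → β} {f : γ → β → α → β} {B : γ → ℕ}
    (hf : PT fun p : γ × β × α => f p.1 p.2.1 p.2.2) (hb : PT b) (hl : PT l)
    (hB : PolyBounded B) (h : ∀ x k, sz (((l x).take k).foldl (f x) (b x)) ≤ B x) :
    PT fun x => (l x).foldl (f x) (b x) := by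
  let g : γ → β × List α → β × List α := fun x s => match s.2 with
    | [] => s
    | a :: t => (f x s.1 a, t)
  have key : ∀ x k, (g x)^[k] (b x, l x) = (((l x).take k).foldl (f x) (b x), (l x).drop k) := by
    intro x k
    induction k with
    | zero => simp
    | succ k ih =>
      rw [Function.iterate_succ_apply', ih]
      simp only [g]
      rcases hd : (l x).drop k with _ | ⟨a, t⟩
      · have := List.drop_eq_nil_iff.1 hd
        rw [List.take_of_length_le this, List.take_of_length_le (this.trans (Nat.le_succ k)),
          List.drop_eq_nil_iff.2 (this.trans (Nat.le_succ k))]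
      · have hk : (l x)[k]? = some a := by
          rw [← List.head?_drop, hd]; rfl
        rw [List.take_add_one, hk, List.foldl_append, ← List.drop_drop, hd]
        simp
  have hg : PT fun p : γ × (β × List α) => g p.1 p.2 := by
    refine PT.listCases (l := fun p : γ × (β × List α) => p.2.2) (f := fun p => p.2)
      (g := fun p a t => (f p.1 p.2.1 a, t)) (by fun_prop) (by fun_prop) ?_
    exact (hf.comp (f := fun p : (α × List α) × γ × (β × List α) => (p.2.1, p.2.2.1, p.1.1))
      (by fun_prop)).prodMk (by fun_prop)
  -- The size of the list exceeds its length; the surplus rounds find an empty list and change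
  -- nothing.
  have h₁ : PT fun x => ((g x)^[sz (l x)] (b x, l x)).1 := by
    refine PT.fst (PT.iterate (B := fun x => B x + sz (l x) + 1) hg (by fun_prop)
      (by fun_prop) (by fun_prop) fun x k hk => ?_)
    rw [key, sz_pair]
    have := h x k
    have := sz_drop_le (l x) k
    omega
  simpa only [key, List.take_of_length_le (length_lt_sz _).le] using h₁

/-- Growth by an additive amount per step, independent of the accumulator, excludes exponential
blow-up. -/
theorem PT.foldl_of_le {l : γ → List α} {b : γ → β} {f : γ → β → α → β} {B : γ → ℕ}
    (hf : PT fun p : γ × β × α => f p.1 p.2.1 p.2.2) (hb : PT b) (hl : PT l)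
    (hB : PolyBounded B) (h : ∀ x s, ∀ a ∈ l x, sz (f x s a) ≤ sz s + B x) :
    PT fun x => (l x).foldl (f x) (b x) := by
  refine PT.foldl (B := fun x => sz (b x) + sz (l x) * B x) hf hb hl
    (by fun_prop) fun x k => ?_
  have key : ∀ (m : List α) s, (∀ a ∈ m, a ∈ l x) →
      sz (m.foldl (f x) s) ≤ sz s + m.length * B x := by
    intro m
    induction m with
    | nil => simp
    | cons a m ih =>
      intro s hm
      have h₁ := ih (f x s a) fun a ha => hm a (List.mem_cons_of_mem _ ha)
      have h₂ := h x s a (hm a List.mem_cons_self)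
      rw [List.foldl_cons, List.length_cons, Nat.succ_mul]
      omega
  refine (key _ (b x) fun a ha => List.mem_of_mem_take ha).trans ?_
  have : ((l x).take k).length ≤ sz (l x) :=
    (List.length_take_le' k _).trans (length_lt_sz _).le
  gcongr

@[fun_prop]
theorem PT.reverse {l : γ → List α} (hl : PT l) : PT fun x => (l x).reverse := by
  have : PT fun x => (l x).foldl (fun s a => a :: s) [] :=
    PT.foldl_of_le (B := fun x => sz (l x) + 1) (by fun_prop) (by fun_prop) hl
      (by fun_prop) fun x s a ha => by have := sz_le_of_mem ha; rw [sz_cons]; omega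
  simpa using this

theorem PT.foldr_of_le {l : γ → List α} {b : γ → β} {f : γ → α → β → β} {B : γ → ℕ}
    (hf : PT fun p : γ × α × β => f p.1 p.2.1 p.2.2) (hb : PT b) (hl : PT l)
    (hB : PolyBounded B) (h : ∀ x s, ∀ a ∈ l x, sz (f x a s) ≤ sz s + B x) :
    PT fun x => (l x).foldr (f x) (b x) := by
  have : PT fun x => (l x).reverse.foldl (fun s a => f x a s) (b x) := by
    refine PT.foldl_of_le (f := fun x s a => f x a s) (hf.comp (f := fun p : γ × β × α =>
      (p.1, p.2.2, p.2.1)) (by fun_prop)) hb (by fun_prop) hB fun x s a ha => h x s a (by simpa using ha)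
  simpa using this

theorem PT.foldr {l : γ → List α} {b : γ → β} {f : γ → α → β → β} {B : γ → ℕ}
    (hf : PT fun p : γ × α × β => f p.1 p.2.1 p.2.2) (hb : PT b) (hl : PT l)
    (hB : PolyBounded B) (h : ∀ x k, sz (((l x).drop k).foldr (f x) (b x)) ≤ B x) :
    PT fun x => (l x).foldr (f x) (b x) := by
  have : PT fun x => (l x).reverse.foldl (fun s a => f x a s) (b x) := by
    refine PT.foldl (f := fun x s a => f x a s) (hf.comp (f := fun p : γ × β × α =>
      (p.1, p.2.2, p.2.1)) (by fun_prop)) hb (by fun_prop) hB fun x k => ?_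
    rw [List.take_reverse, List.foldl_reverse]
    exact h x _
  simpa using this

@[fun_prop]
theorem PT.append {l m : γ → List α} (hl : PT l) (hm : PT m) : PT fun x => l x ++ m x := by
  have : PT fun x => (l x).foldr (fun a s => a :: s) (m x) :=
    PT.foldr_of_le (B := fun x => sz (l x) + 1) (by fun_prop) hm hl
      (by fun_prop) fun x s a ha => by have := sz_le_of_mem ha; rw [sz_cons]; omega
  simpa using this

theorem PolyBounded.exists_sz_mem {f : γ → α → β} {l : γ → List α}
    (hf : PT fun p : γ × α => f p.1 p.2) (hl : PT l) :
    ∃ B, PolyBounded B ∧ ∀ x, ∀ a ∈ l x, sz (f x a) ≤ B x := by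
  obtain ⟨q, hq⟩ := hf.polyBounded_sz
  refine ⟨fun x => q.eval (sz x + sz (l x) + 1), PolyBounded.eval ?_ q,
    fun x a ha => (hq (x, a)).trans (q.eval_mono_nat ?_)⟩
  · have := PolyBounded.self (α := γ)
    fun_prop
  · have := sz_le_of_mem ha
    rw [sz_pair]
    omega

@[fun_prop]
theorem PT.map {f : γ → α → β} {l : γ → List α} (hf : PT fun p : γ × α => f p.1 p.2) (hl : PT l) :
    PT fun x => (l x).map (f x) := by
  obtain ⟨B, hB, h⟩ := PolyBounded.exists_sz_mem hf hl
  have : PT fun x => (l x).foldr (fun a s => f x a :: s) [] :=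
    PT.foldr_of_le (f := fun x a s => f x a :: s) (B := fun x => B x + 1)
      (PT.cons (hf.comp (f := fun p : γ × α × List β => (p.1, p.2.1)) (by fun_prop))
        (by fun_prop)) (by fun_prop) hl (by fun_prop) fun x s a ha => by
          have := h x a ha; rw [sz_cons]; omega
  refine this.congr fun x => ?_
  induction l x <;> simp_all

@[fun_prop]
theorem PT.flatMap {f : γ → α → List β} {l : γ → List α} (hf : PT fun p : γ × α => f p.1 p.2)
    (hl : PT l) : PT fun x => (l x).flatMap (f x) := by
  obtain ⟨B, hB, h⟩ := PolyBounded.exists_sz_mem hf hl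
  have : PT fun x => (l x).foldr (fun a s => f x a ++ s) [] :=
    PT.foldr_of_le (f := fun x a s => f x a ++ s) (B := B)
      (PT.append (hf.comp (f := fun p : γ × α × List β => (p.1, p.2.1)) (by fun_prop))
        (by fun_prop)) (by fun_prop) hl (by fun_prop) fun x s a ha => by
          have := h x a ha; have := sz_append (f x a) s; omega
  refine this.congr fun x => ?_
  induction l x <;> simp_all

@[fun_prop]
theorem PT.filter {f : γ → α → Bool} {l : γ → List α} (hf : PT fun p : γ × α => f p.1 p.2)
    (hl : PT l) : PT fun x => (l x).filter (f x) := by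
  have : PT fun x => (l x).flatMap fun a => bif f x a then [a] else [] :=
    PT.flatMap (f := fun x a => bif f x a then [a] else []) (by fun_prop) hl
  refine this.congr fun x => ?_
  induction l x with
  | nil => rfl
  | cons a l ih => cases h : f x a <;> simp [h, ih]

@[fun_prop]
theorem PT.or {f g : γ → Bool} (hf : PT f) (hg : PT g) : PT fun x => f x || g x := by
  refine PT.congr (hf.cond (PT.const true) hg) fun x => ?_
  cases f x <;> rfl

@[fun_prop]
theorem PT.and {f g : γ → Bool} (hf : PT f) (hg : PT g) : PT fun x => f x && g x := by
  refine PT.congr (hf.cond hg (PT.const false)) fun x => ?_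
  cases f x <;> rfl

@[fun_prop]
theorem PT.not {f : γ → Bool} (hf : PT f) : PT fun x => !f x := by
  refine PT.congr (hf.cond (PT.const false) (PT.const true)) fun x => ?_
  cases f x <;> rfl

@[fun_prop]
theorem PT.any {f : γ → α → Bool} {l : γ → List α} (hf : PT fun p : γ × α => f p.1 p.2)
    (hl : PT l) : PT fun x => (l x).any (f x) := by
  have : PT fun x => (l x).foldr (fun a s => f x a || s) false :=
    PT.foldr_of_le (f := fun x a s => f x a || s) (B := fun _ => 3)
      (PT.or (hf.comp (f := fun p : γ × α × Bool => (p.1, p.2.1)) (by fun_prop))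
        (by fun_prop)) (by fun_prop) hl (by fun_prop) fun x s a ha =>
          (sz_bool_le _).trans (Nat.le_add_left _ _)
  refine this.congr fun x => ?_
  induction l x <;> simp_all

@[fun_prop]
theorem PT.all {f : γ → α → Bool} {l : γ → List α} (hf : PT fun p : γ × α => f p.1 p.2)
    (hl : PT l) : PT fun x => (l x).all (f x) := by
  have : PT fun x => !(l x).any fun a => !f x a :=
    PT.not (PT.any (f := fun x a => !f x a) (by fun_prop) hl)
  simpa [List.all_eq_not_any_not] using this

@[fun_prop]
theorem PT.length {l : γ → List α} (hl : PT l) : PT fun x => (l x).length := by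
  have : PT fun x => (l x).foldr (fun _ n => n + 1) 0 :=
    PT.foldr_of_le (f := fun _ _ n => n + 1) (B := fun _ => 2) (by fun_prop) (by fun_prop) hl
      (by fun_prop) fun x s a ha => by rw [sz_nat, sz_nat]; omega
  refine this.congr fun x => ?_
  induction l x <;> simp_all

@[fun_prop]
theorem PT.pred {f : γ → ℕ} (hf : PT f) : PT fun x => f x - 1 := by
  refine PT.congr (PT.natCases (g := fun _ k => k) hf (PT.const 0) (by fun_prop)) fun x => ?_
  cases f x <;> rfl

@[fun_prop]
theorem PT.sub {f g : γ → ℕ} (hf : PT f) (hg : PT g) : PT fun x => f x - g x := by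
  have key : ∀ x k, Nat.pred^[k] (f x) = f x - k := fun x k => Nat.pred_iterate (f x) k
  have : PT fun x => Nat.pred^[g x] (f x) :=
    PT.iterate (f := fun _ n => Nat.pred n) (B := fun x => sz (f x))
      (PT.pred (f := fun p : γ × ℕ => p.2) (by fun_prop)) hg hf (by fun_prop)
      fun x k _ => by rw [key, sz_nat, sz_nat]; omega
  simpa only [key] using this

@[fun_prop]
theorem PT.add {f g : γ → ℕ} (hf : PT f) (hg : PT g) : PT fun x => f x + g x := by
  have key : ∀ x k, Nat.succ^[k] (f x) = f x + k := fun x k => Nat.succ_iterate (f x) k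
  have : PT fun x => Nat.succ^[g x] (f x) :=
    PT.iterate (f := fun _ n => Nat.succ n) (B := fun x => sz (f x) + sz (g x))
      (PT.succ (f := fun p : γ × ℕ => p.2) (by fun_prop)) hg hf (by fun_prop)
      fun x k _ => by rw [key, sz_nat, sz_nat, sz_nat]; omega
  simpa only [key] using this

@[fun_prop]
theorem PT.mul {f g : γ → ℕ} (hf : PT f) (hg : PT g) : PT fun x => f x * g x := by
  have key : ∀ x k, (fun n => n + f x)^[k] 0 = f x * k := fun x k => by
    induction k with
    | zero => rfl
    | succ k ih => rw [Function.iterate_succ_apply', ih, Nat.mul_succ]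
  have : PT fun x => (fun n => n + f x)^[g x] 0 :=
    PT.iterate (f := fun x n => n + f x) (B := fun x => 2 * (sz (f x) * sz (g x)) + 1)
      (by fun_prop) hg (by fun_prop) (by fun_prop)
      fun x k hk => by
        have : f x * k ≤ sz (f x) * sz (g x) :=
          Nat.mul_le_mul (by rw [sz_nat]; omega) (by rw [sz_nat]; omega)
        rw [key, sz_nat]; omega
  simpa only [key] using this

@[fun_prop]
theorem PT.decide_lt {f g : γ → ℕ} (hf : PT f) (hg : PT g) : PT fun x => decide (f x < g x) := by
  refine PT.congr (PT.natCases (n := fun x => g x - f x) (g := fun _ _ => true) (by fun_prop) (PT.const false)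
      (by fun_prop)) fun x => ?_
  rcases h : g x - f x with _ | k
  · simp; omega
  · simp; omega

@[fun_prop]
theorem PT.decide_le {f g : γ → ℕ} (hf : PT f) (hg : PT g) : PT fun x => decide (f x ≤ g x) := by
  have : PT fun x => decide (f x < g x + 1) := by fun_prop
  simpa [Nat.lt_succ_iff] using this

@[fun_prop]
theorem PT.zip {l : γ → List α} {m : γ → List β} (hl : PT l) (hm : PT m) :
    PT fun x => (l x).zip (m x) := by
  let f : List β × List (α × β) → α → List β × List (α × β) := fun s a => match s.1 with
    | [] => s
    | b :: t => (t, (a, b) :: s.2)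
  have hf : PT fun p : γ × (List β × List (α × β)) × α => f p.2.1 p.2.2 :=
    PT.listCases (l := fun p : γ × (List β × List (α × β)) × α => p.2.1.1)
      (f := fun p => p.2.1) (g := fun p b t => (t, (p.2.2, b) :: p.2.1.2)) (by fun_prop)
      (by fun_prop) (by fun_prop)
  have key : ∀ (l : List α) (m : List β) s, (l.foldl f (m, s)).2 = (l.zip m).reverse ++ s := by
    intro l
    induction l with
    | nil => simp
    | cons a l ih =>
      intro m s
      rcases m with _ | ⟨b, m⟩
      · have : ∀ l : List α, l.foldl f ([], s) = ([], s) := by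
          intro l; induction l <;> simp_all [f]
        rw [this]; simp
      · simp [f, ih]
  have : PT fun x => ((l x).foldl f (m x, [])).2.reverse := by
    refine PT.reverse (PT.snd (PT.foldl_of_le (f := fun _ => f)
      (B := fun x => sz (l x) + 2) hf (by fun_prop) hl
      (by fun_prop) fun x s a ha => ?_))
    have := sz_le_of_mem ha
    obtain ⟨_ | ⟨b, t⟩, s⟩ := s <;> simp [f] <;> omega
  simpa only [key, List.append_nil, List.reverse_reverse] using this

theorem PT.decide_eq_list_bool {l m : γ → List Bool} (hl : PT l) (hm : PT m) :
    PT fun x => decide (l x = m x) := by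
  have : PT fun x => decide ((l x).length ≤ (m x).length) &&
      (decide ((m x).length ≤ (l x).length) &&
        ((l x).zip (m x)).all fun p => bif p.1 then p.2 else !p.2) := by fun_prop
  refine this.congr fun x => ?_
  rw [Bool.eq_iff_iff]
  simp only [Bool.and_eq_true, decide_eq_true_eq, ← and_assoc]
  generalize l x = l
  generalize m x = m
  induction l generalizing m with
  | nil => cases m <;> simp
  | cons a l ih =>
    cases m with
    | nil => simp
    | cons b m =>
      simp only [List.length_cons, List.zip_cons_cons, List.all_cons, Bool.and_eq_true,
        List.cons.injEq, ← ih]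
      cases a <;> cases b <;> simp

@[fun_prop]
theorem PT.decide_eq {f g : γ → BinTree} (hf : PT f) (hg : PT g) :
    PT fun x => decide (f x = g x) := by
  have := PT.decide_eq_list_bool hf.spell hg.spell
  simpa only [BinTree.code_injective.eq_iff] using this

end

/-! ### AC-unification of linear terms without common variables -/

namespace ACSignature

open FirstOrder.Language (Term)

variable {S : ACSignature}

/-- The variables of a term, with multiplicity. -/
def vars : S.Term → Multiset ℕ
  | .var x => {x}
  | .func _ ts => ∑ i, vars (ts i)

theorem count_vars (x : ℕ) (t : S.Term) : (vars t).count x = occurrences x t := by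
  induction t with
  | var y => simp [vars, occurrences, Multiset.count_singleton, eq_comm]
  | func f ts ih => simp [vars, occurrences, Multiset.count_sum', ih]

theorem mem_vars {x : ℕ} {t : S.Term} : x ∈ vars t ↔ x ∈ t.varFinset := by
  induction t with
  | var y => simp [vars, Term.varFinset]
  | func f ts ih => simp [vars, Term.varFinset, Multiset.mem_sum, ih]

theorem IsDO.nodup {t : S.Term} (h : IsDO t) : (vars t).Nodup := by
  rw [Multiset.nodup_iff_count_le_one]
  intro x
  by_cases hx : x ∈ vars t
  · rw [count_vars, h x (mem_vars.1 hx)]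
  · rw [Multiset.count_eq_zero_of_notMem hx]; omega

theorem subst_congr {t : S.Term} {σ τ : ℕ → S.Term} (h : ∀ x ∈ vars t, σ x = τ x) :
    t.subst σ = t.subst τ := by
  induction t with
  | var y => exact h y (by simp [vars])
  | func f ts ih =>
    simp only [Term.subst]
    congr 1
    funext i
    exact ih i fun x hx => h x (Multiset.mem_sum.2 ⟨i, Finset.mem_univ i, hx⟩)

theorem subst_var (t : S.Term) : t.subst Term.var = t := by
  induction t with
  | var y => rfl
  | func f ts ih => simp [Term.subst, ih]

theorem subst_eq_self {t : S.Term} {σ : ℕ → S.Term} (h : ∀ x ∈ vars t, σ x = .var x) :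
    t.subst σ = t := by
  rw [subst_congr h, subst_var]

theorem subst_subst (t : S.Term) (σ τ : ℕ → S.Term) :
    (t.subst σ).subst τ = t.subst fun x => (σ x).subst τ := by
  induction t with
  | var y => rfl
  | func f ts ih => simp [Term.subst, ih]

theorem subst_pair (f : S.language.Functions 2) (s t : S.Term) (σ : ℕ → S.Term) :
    (Term.func f ![s, t]).subst σ = .func f ![s.subst σ, t.subst σ] := by
  simp only [Term.subst]
  congr 1
  funext i
  fin_cases i <;> rfl

theorem ACEq.subst {s t : S.Term} (h : ACEq s t) (σ : ℕ → S.Term) :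
    ACEq (s.subst σ) (t.subst σ) := by
  induction h with
  | refl t => exact .refl _
  | symm _ ih => exact .symm ih
  | trans _ _ ih ih' => exact .trans ih ih'
  | congr f _ ih => exact .congr f ih
  | comm f hf s t => rw [subst_pair, subst_pair]; exact .comm f hf _ _
  | assoc f hf s t u => simp only [subst_pair]; exact .assoc f hf _ _ _

/-- Terms up to equality modulo associativity and commutativity. -/
def acSetoid (S : ACSignature) : Setoid S.Term := ⟨ACEq, ⟨.refl, .symm, .trans⟩⟩

/-- The class of a term. -/
def acClass (t : S.Term) : Quotient S.acSetoid := Quotient.mk _ t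

theorem acClass_eq {s t : S.Term} : acClass s = acClass t ↔ ACEq s t := Quotient.eq (r := S.acSetoid)

/-- The multiset of the arguments of a term that is seen as a product formed with `f`. -/
def flat (f : ℕ) : S.Term → Multiset S.Term
  | .var x => {.var x}
  | .func g ts => if g.1 = f then ∑ i, flat f (ts i) else {.func g ts}

/-- A necessary condition for equality modulo associativity and commutativity. -/
def Similar : S.Term → S.Term → Prop
  | .var x, .var y => x = y
  | .func (l := m) f us, .func (l := n) g vs => f.1 = g.1 ∧
      if S.isAC f.1 = true then (flat f.1 (.func f us)).map acClass = (flat f.1 (.func g vs)).map acClass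
      else ∀ (i : Fin m) (j : Fin n), i.1 = j.1 → acClass (us i) = acClass (vs j)
  | _, _ => False

theorem map_acClass_flat_eq {f : ℕ} (hf : S.isAC f = true) {s t : S.Term} (h : ACEq s t)
    (h' : Similar s t) : (flat f s).map acClass = (flat f t).map acClass := by
  cases s with
  | var x => cases t with
    | var y => cases h'; rfl
    | func g vs => exact h'.elim
  | func g us => cases t with
    | var y => exact h'.elim
    | func g' vs =>
      obtain ⟨hg, h'⟩ := h'
      by_cases hgf : g.1 = f
      · subst hgf
        rwa [if_pos hf] at h'
      · simp only [flat, if_neg hgf, if_neg (hg ▸ hgf : ¬ g'.1 = f), Multiset.map_singleton,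
          acClass_eq.2 h]

theorem arity_eq {n m : ℕ} {f : S.language.Functions n} {g : S.language.Functions m}
    (h : f.1 = g.1) : n = m := by
  rw [← f.2.2, ← g.2.2, h]

/-- The inversion principle for `ACEq`, which cannot be inverted by cases because of `symm` and
`trans`. Every generating rule preserves the data recorded at the root; for `comm` and `assoc` this
is commutativity and associativity of multiset addition. -/
theorem ACEq.similar {s t : S.Term} (h : ACEq s t) : Similar s t := by
  induction h with
  | refl t =>
    cases t with
    | var x => rfl
    | func f ts =>
      refine ⟨rfl, ?_⟩
      split_ifs
      · rfl
      · intro i j hij; rw [Fin.ext hij]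
  | @symm s t _ ih =>
    cases s <;> cases t
    · exact ih.symm
    · exact ih
    · exact ih
    · obtain ⟨hfg, h⟩ := ih
      refine ⟨hfg.symm, ?_⟩
      rw [hfg] at h
      split_ifs at h ⊢
      · exact h.symm
      · exact fun i j hij => (h j i hij.symm).symm
  | @trans s t u _ _ ih ih' =>
    cases s <;> cases t <;> cases u <;> try first | exact ih.elim | exact ih'.elim
    · exact ih.trans ih'
    · obtain ⟨hfg, h⟩ := ih
      obtain ⟨hfg', h'⟩ := ih'
      refine ⟨hfg.trans hfg', ?_⟩
      rw [← hfg] at h'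
      split_ifs at h h' ⊢
      · exact h.trans h'
      · intro i j hij
        -- Equal symbols have equal arities only propositionally, so the index is transported to the
        -- middle term.
        exact (h i (i.cast (arity_eq hfg)) rfl).trans (h' _ j hij)
  | @congr n f ss ts h ih =>
    refine ⟨rfl, ?_⟩
    split_ifs with hf
    · simp only [flat, if_true]
      have := fun i => map_acClass_flat_eq hf (h i) (ih i)
      rw [← Multiset.coe_mapAddMonoidHom, map_sum, map_sum]
      exact Finset.sum_congr rfl fun i _ => this i
    · intro i j hij
      rw [Fin.ext hij]
      exact acClass_eq.2 (h j)
  | comm f hf s t =>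
    refine ⟨rfl, ?_⟩
    rw [if_pos hf]
    simp [flat, Fin.sum_univ_two, add_comm]
  | assoc f hf s t u =>
    refine ⟨rfl, ?_⟩
    rw [if_pos hf]
    simp [flat, Fin.sum_univ_two, add_assoc]

section product

variable (F : S.language.Functions 2) (hF : S.isAC F.1 = true)

/-- The semigroup that an associative-commutative symbol defines on the classes of terms. -/
def ACQuotient (_F : S.language.Functions 2) (_hF : S.isAC _F.1 = true) : Type :=
  Quotient S.acSetoid

/-- With a unit adjoined by `WithOne` this becomes a commutative monoid, in which products over
multisets of arguments make bracketing and order disappear. -/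
instance : CommSemigroup (ACQuotient F hF) where
  mul := Quotient.map₂ (fun s t => .func F ![s, t]) fun s s' hs t t' ht =>
    ACEq.congr F fun i => by fin_cases i; exacts [hs, ht]
  mul_assoc a b c := by
    induction a using Quotient.inductionOn with | _ a
    induction b using Quotient.inductionOn with | _ b
    induction c using Quotient.inductionOn with | _ c
    exact Quotient.sound (ACEq.assoc F hF a b c).symm
  mul_comm a b := by
    induction a using Quotient.inductionOn with | _ a
    induction b using Quotient.inductionOn with | _ b
    exact Quotient.sound (ACEq.comm F hF a b)

/-- The class of a term, as an element of the monoid in which products formed with `F` become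
products. -/
def cls (t : S.Term) : WithOne (ACQuotient F hF) := WithOne.coe (α := ACQuotient F hF) (acClass t)

theorem cls_inj {s t : S.Term} : cls F hF s = cls F hF t ↔ ACEq s t :=
  WithOne.coe_inj.trans acClass_eq

theorem cls_func (s t : S.Term) : cls F hF (.func F ![s, t]) = cls F hF s * cls F hF t := rfl

theorem flat_pair (s t : S.Term) : flat F.1 (.func F ![s, t]) = flat F.1 s + flat F.1 t := by
  simp [flat, Fin.sum_univ_two]

theorem vars_pair (s t : S.Term) : vars (.func F ![s, t]) = vars s + vars t := by
  simp [vars, Fin.sum_univ_two]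

/-- A term is a product formed with `F` or a single factor. The second hypothesis of `h₁` records
that a factor which is not a variable keeps its head, and so stays a single factor, under every
substitution. -/
theorem flat_induction {P : S.Term → Prop} (h₁ : ∀ t, flat F.1 t = {t} →
      (∀ σ : ℕ → S.Term, (∀ x, t ≠ .var x) → flat F.1 (t.subst σ) = {t.subst σ}) → P t)
    (h₂ : ∀ s t, P s → P t → P (.func F ![s, t])) (t : S.Term) : P t := by
  induction t with
  | var x => exact h₁ _ rfl fun σ h => (h x rfl).elim
  | func g ts ih =>
    by_cases hg : g.1 = F.1
    · obtain rfl := arity_eq hg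
      obtain rfl : g = F := Subtype.ext hg
      have : ts = ![ts 0, ts 1] := by funext i; fin_cases i <;> rfl
      rw [this]
      exact h₂ _ _ (ih 0) (ih 1)
    · exact h₁ _ (by simp [flat, hg]) fun σ _ => by simp [flat, hg, Term.subst]

theorem cls_subst (σ : ℕ → S.Term) (t : S.Term) :
    cls F hF (t.subst σ) = ((flat F.1 t).map fun a => cls F hF (a.subst σ)).prod := by
  induction t using flat_induction F with
  | h₁ t h _ => simp [h]
  | h₂ s t hs ht => rw [subst_pair, cls_func, flat_pair, Multiset.map_add, Multiset.prod_add, hs, ht]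

theorem flat_subst (σ : ℕ → S.Term) (t : S.Term) :
    flat F.1 (t.subst σ) = (flat F.1 t).bind fun a => flat F.1 (a.subst σ) := by
  induction t using flat_induction F with
  | h₁ t h _ => simp [h]
  | h₂ s t hs ht => rw [subst_pair, flat_pair, flat_pair, Multiset.add_bind, hs, ht]

/-- Through this identity the flattened arguments inherit linearity and disjointness of variables.
-/
theorem sum_vars_flat (t : S.Term) : ((flat F.1 t).map vars).sum = vars t := by
  induction t using flat_induction F with
  | h₁ t h _ => simp [h]
  | h₂ s t hs ht => rw [vars_pair, flat_pair, Multiset.map_add, Multiset.sum_add, hs, ht]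

theorem flat_subst_of_mem {t a : S.Term} (h : a ∈ flat F.1 t) (σ : ℕ → S.Term)
    (ha : ∀ x, a ≠ .var x) : flat F.1 (a.subst σ) = {a.subst σ} := by
  induction t using flat_induction F with
  | h₁ t h' h'' =>
    rw [h', Multiset.mem_singleton] at h
    subst h
    exact h'' σ ha
  | h₂ s t hs ht =>
    rw [flat_pair, Multiset.mem_add] at h
    exact h.elim hs ht

theorem flat_ne_zero (t : S.Term) : flat F.1 t ≠ 0 := by
  induction t using flat_induction F with
  | h₁ t h _ => simp [h]
  | h₂ s t hs ht => rw [flat_pair]; simp [hs]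

/-- Supplies the terms by which a variable absorbs several factors. The separate `b` keeps the
product nonempty, as there is no term for the unit. -/
theorem exists_product (M : Multiset S.Term) (b : S.Term) : ∃ u : S.Term,
    (∀ σ : ℕ → S.Term, cls F hF (u.subst σ) = ((b ::ₘ M).map fun a => cls F hF (a.subst σ)).prod) ∧
      vars u = ((b ::ₘ M).map vars).sum := by
  induction M using Multiset.induction_on generalizing b with
  | empty => exact ⟨b, by simp, by simp⟩
  | cons a M ih =>
    obtain ⟨u, hu, hv⟩ := ih a
    refine ⟨.func F ![b, u], fun σ => ?_, ?_⟩
    · rw [subst_pair, cls_func, hu, Multiset.map_cons _ b, Multiset.prod_cons]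
    · rw [vars_pair, hv, Multiset.map_cons _ b, Multiset.sum_cons]

end product

theorem notMem_of_nodup_add {m n : Multiset ℕ} (h : (m + n).Nodup) {x : ℕ} (hx : x ∈ m) : x ∉ n :=
  Multiset.disjoint_left.1 (Multiset.nodup_add.1 h).2.2 hx

/-- Unifiability by an arbitrary map from variables to terms. -/
def Unif (s t : S.Term) : Prop := ∃ σ : ℕ → S.Term, ACEq (s.subst σ) (t.subst σ)

theorem Unif.symm {s t : S.Term} : Unif s t → Unif t s := fun ⟨σ, h⟩ => ⟨σ, .symm h⟩

/-- The restriction that the term put for `x` avoids `x` costs nothing: after unifying, all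
variables of the values can be renamed to fresh ones, and equality modulo AC survives the renaming.
-/
theorem acUnifiable_iff {s t : S.Term} : ACUnifiable s t ↔ Unif s t := by
  constructor
  · exact fun ⟨θ, h⟩ => ⟨_, h⟩
  · rintro ⟨σ, h⟩
    -- The sum of the names bounds each of them, so shifting by `N` leads outside all variables that
    -- occur.
    let N := (vars s + vars t).sum + 1
    have hN : ∀ x ∈ vars s + vars t, x < N := fun x hx =>
      Nat.lt_succ_of_le (Multiset.single_le_sum (fun _ _ => Nat.zero_le _) x hx)
    let ρ : ℕ → S.Term := fun y => .var (y + N)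
    have hρ : ∀ u : S.Term, ∀ y ∈ vars (u.subst ρ), N ≤ y := by
      intro u
      induction u with
      | var z => simp [Term.subst, vars, ρ]
      | func f ts ih =>
        intro y hy
        simp only [Term.subst, vars, Multiset.mem_sum] at hy
        obtain ⟨i, _, hy⟩ := hy
        exact ih i y hy
    refine ⟨⟨fun x => if x ∈ vars s + vars t then some ((σ x).subst ρ) else none, ?_⟩, ?_⟩
    · intro x u hu hx
      split_ifs at hu with hxs
      cases hu
      have := hρ _ _ (mem_vars.2 hx)
      have := hN x hxs
      omega
    · have := h.subst ρ
      rw [subst_subst, subst_subst] at this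
      unfold Substitution.apply
      rw [subst_congr (t := s) (τ := fun x => (σ x).subst ρ),
        subst_congr (t := t) (τ := fun x => (σ x).subst ρ)]
      · exact this
      · intro x hx; simp [hx]
      · intro x hx; simp [hx]

theorem unif_var_left {x : ℕ} {t : S.Term} (h : x ∉ vars t) : Unif (.var x) t := by
  refine ⟨Function.update Term.var x t, ?_⟩
  rw [subst_eq_self (t := t)]
  · simp only [Term.subst, Function.update_self]
    exact .refl t
  · intro y hy
    rw [Function.update_of_ne]
    rintro rfl
    exact h hy

theorem not_unif_of_ne {m n : ℕ} {f : S.language.Functions m} {g : S.language.Functions n}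
    {ss : Fin m → S.Term} {ts : Fin n → S.Term} (h : f.1 ≠ g.1) :
    ¬ Unif (.func f ss) (.func g ts) := fun ⟨_, hσ⟩ => h hσ.similar.1

theorem eq_of_nodup_sum {n : ℕ} {m : Fin n → Multiset ℕ} (h : (∑ i, m i).Nodup) {x : ℕ}
    {i j : Fin n} (hi : x ∈ m i) (hj : x ∈ m j) : i = j := by
  by_contra hij
  have h₁ := Multiset.nodup_iff_count_le_one.1 h x
  rw [Multiset.count_sum'] at h₁
  have h₂ := Finset.add_le_sum (f := fun i => (m i).count x) (s := Finset.univ)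
    (fun _ _ => Nat.zero_le _) (Finset.mem_univ i) (Finset.mem_univ j) hij
  have := Multiset.count_pos.2 hi
  have := Multiset.count_pos.2 hj
  omega

/-- By linearity a variable belongs to at most one argument position, so the unifiers of the
positions glue to one map. -/
theorem unif_free {n : ℕ} {f : S.language.Functions n} (hf : S.isAC f.1 ≠ true)
    {ss ts : Fin n → S.Term} (h : (vars (.func f ss) + vars (.func f ts)).Nodup) :
    Unif (.func f ss) (.func f ts) ↔ ∀ i, Unif (ss i) (ts i) := by
  constructor
  · rintro ⟨σ, hσ⟩ i
    have := hσ.similar.2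
    rw [if_neg hf] at this
    exact ⟨σ, acClass_eq.1 (this i i rfl)⟩
  · intro hu
    choose σ hσ using hu
    simp only [vars, ← Finset.sum_add_distrib] at h
    classical
    refine ⟨fun x => if h : ∃ i, x ∈ vars (ss i) + vars (ts i) then σ h.choose x else .var x,
      ACEq.congr f fun i => ?_⟩
    have key : ∀ x ∈ vars (ss i) + vars (ts i),
        (if h : ∃ i, x ∈ vars (ss i) + vars (ts i) then σ h.choose x else .var x) = σ i x := by
      intro x hx
      have hex : ∃ i, x ∈ vars (ss i) + vars (ts i) := ⟨i, hx⟩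
      rw [dif_pos hex, eq_of_nodup_sum h hex.choose_spec hx]
    rw [subst_congr fun x hx => key x (Multiset.mem_add.2 (.inl hx)),
      subst_congr fun x hx => key x (Multiset.mem_add.2 (.inr hx))]
    exact hσ i

/-- The multiset counterpart of the gluing for free symbols: the matched pairs have pairwise
disjoint variables. -/
theorem exists_common_unifier {A B : Multiset S.Term} (h : Multiset.Rel Unif A B)
    (hn : ((A.map vars).sum + (B.map vars).sum).Nodup) :
    ∃ σ : ℕ → S.Term, Multiset.Rel (fun a b => ACEq (a.subst σ) (b.subst σ)) A B := by
  induction h with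
  | zero => exact ⟨Term.var, .zero⟩
  | @cons a b A B hab _ ih =>
    obtain ⟨σ, hσ⟩ := hab
    rw [Multiset.map_cons, Multiset.map_cons, Multiset.sum_cons, Multiset.sum_cons,
      add_add_add_comm, Multiset.nodup_add] at hn
    obtain ⟨-, hn, hd⟩ := hn
    obtain ⟨τ, hτ⟩ := ih hn
    classical
    refine ⟨fun x => if x ∈ vars a + vars b then σ x else τ x, .cons ?_ (hτ.mono ?_)⟩
    · rw [subst_congr (τ := σ) fun x hx => if_pos (Multiset.mem_add.2 (.inl hx)),
        subst_congr (τ := σ) fun x hx => if_pos (Multiset.mem_add.2 (.inr hx))]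
      exact hσ
    · intro a' ha' b' hb' h
      have hx : ∀ x ∈ (A.map vars).sum + (B.map vars).sum,
          (if x ∈ vars a + vars b then σ x else τ x) = τ x :=
        fun x hx => if_neg fun hx' => Multiset.disjoint_left.1 hd hx' hx
      rw [subst_congr (τ := τ) fun x hx' => hx x (Multiset.mem_add.2 (.inl ?_)),
        subst_congr (τ := τ) fun x hx' => hx x (Multiset.mem_add.2 (.inr ?_))]
      · exact h
      · exact Multiset.mem_of_le (Multiset.single_le_sum (fun _ _ => Multiset.zero_le _) _
          (Multiset.mem_map_of_mem _ hb')) hx'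
      · exact Multiset.mem_of_le (Multiset.single_le_sum (fun _ _ => Multiset.zero_le _) _
          (Multiset.mem_map_of_mem _ ha')) hx'

/-- Every element of `A` has its own partner in `B`. -/
def Matches {α β : Type} (r : α → β → Prop) (A : Multiset α) (B : Multiset β) : Prop :=
  ∃ B' ≤ B, Multiset.Rel r A B'

/-- Greedy choice suffices, because the `D a` occupy disjoint parts of `B.map c`: take any member of
`D a` as partner of `a`, delete it, and continue. -/
theorem matches_of_bind_le {α β γ : Type} {A : Multiset α} {D : α → Multiset γ} {B : Multiset β}
    {c : β → γ} (hD : ∀ a ∈ A, D a ≠ 0) (h : A.bind D ≤ B.map c) :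
    Matches (fun a b => c b ∈ D a) A B := by
  classical
  induction A using Multiset.induction_on generalizing B with
  | empty => exact ⟨0, Multiset.zero_le _, .zero⟩
  | cons a A ih =>
    obtain ⟨q, hq⟩ := Multiset.exists_mem_of_ne_zero (hD a (Multiset.mem_cons_self _ _))
    rw [Multiset.cons_bind] at h
    obtain ⟨b, hb, rfl⟩ := Multiset.mem_map.1
      (Multiset.mem_of_le h (Multiset.mem_add.2 (.inl hq)))
    obtain ⟨B, rfl⟩ := Multiset.exists_cons_of_mem hb
    rw [Multiset.map_cons] at h
    have h' : A.bind D ≤ B.map c := by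
      rw [← Multiset.cons_le_cons_iff (c b), ← Multiset.singleton_add]
      exact (add_le_add_left (Multiset.singleton_le.2 hq) _).trans h
    obtain ⟨B', hB', hr⟩ := ih (fun a ha => hD a (Multiset.mem_cons_of_mem ha)) h'
    exact ⟨b ::ₘ B', Multiset.cons_le_cons _ hB', .cons hq hr⟩

section ac

variable {F : S.language.Functions 2} (hF : S.isAC F.1 = true) {s t : S.Term}

include hF in
theorem unif_of_rel {A B : Multiset S.Term} (h : Multiset.Rel Unif A B)
    (hn : ((A.map vars).sum + (B.map vars).sum).Nodup) : ∃ σ : ℕ → S.Term,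
      (A.map fun a => cls F hF (a.subst σ)).prod = (B.map fun a => cls F hF (a.subst σ)).prod := by
  obtain ⟨σ, hσ⟩ := exists_common_unifier h hn
  refine ⟨σ, congrArg _ (Multiset.rel_eq.1 (Multiset.rel_map.2 (hσ.mono ?_)))⟩
  exact fun a _ b _ h => (cls_inj F hF).2 h

include hF

/-- Write `s` as `x` times the product of `A` and `t` as `y` times the product of `B`. Sending `x`
to `x` times `B` and `y` to `x` times `A` turns both into `x` times `A` times `B`. The additional
`x` covers the case that `A` or `B` is empty. -/
theorem unif_of_mem_flat {x y : ℕ} (hn : (vars s + vars t).Nodup) (hx : .var x ∈ flat F.1 s)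
    (hy : .var y ∈ flat F.1 t) : Unif s t := by
  obtain ⟨A, hA⟩ := Multiset.exists_cons_of_mem hx
  obtain ⟨B, hB⟩ := Multiset.exists_cons_of_mem hy
  have hs := sum_vars_flat F s
  have ht := sum_vars_flat F t
  obtain ⟨u, hu, -⟩ := exists_product F hF B (.var x)
  obtain ⟨w, hw, -⟩ := exists_product F hF A (.var x)
  rw [← hs, ← ht, hA, hB] at hn
  simp only [Multiset.map_cons, Multiset.sum_cons, vars, Multiset.singleton_add,
    Multiset.cons_add, Multiset.add_cons, Multiset.nodup_cons, Multiset.mem_cons,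
    Multiset.mem_add, not_or] at hn
  obtain ⟨hy', hx', -⟩ := hn
  let σ : ℕ → S.Term := Function.update (Function.update Term.var x u) y w
  have hσx : σ x = u := by simp only [σ]; rw [Function.update_of_ne (by tauto)]; simp
  have hσy : σ y = w := by simp [σ]
  have hσ : ∀ z, z ≠ x → z ≠ y → σ z = .var z := fun z h₁ h₂ => by
    simp only [σ]; rw [Function.update_of_ne h₂, Function.update_of_ne h₁]
  have hmem : ∀ (M : Multiset S.Term) a, a ∈ M → ∀ z ∈ vars a, z ∈ (M.map vars).sum :=
    fun M a ha z hz => Multiset.mem_of_le (Multiset.single_le_sum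
      (fun _ _ => Multiset.zero_le _) _ (Multiset.mem_map_of_mem _ ha)) hz
  have hA' : ∀ a ∈ A, a.subst σ = a := fun a ha => subst_eq_self fun z hz => hσ z
    (by rintro rfl; exact hx'.1 (hmem A a ha _ ‹_›)) (by rintro rfl; exact hy'.2.1 (hmem A a ha _ ‹_›))
  have hB' : ∀ a ∈ B, a.subst σ = a := fun a ha => subst_eq_self fun z hz => hσ z
    (by rintro rfl; exact hx'.2 (hmem B a ha _ ‹_›)) (by rintro rfl; exact hy'.2.2 (hmem B a ha _ ‹_›))
  have hu := hu Term.var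
  have hw := hw Term.var
  simp only [subst_var, Multiset.map_cons, Multiset.prod_cons] at hu hw
  refine ⟨σ, (cls_inj F hF).1 ?_⟩
  rw [cls_subst, cls_subst, hA, hB]
  simp only [Multiset.map_cons, Multiset.prod_cons, Term.subst, hσx, hσy, hu, hw]
  rw [Multiset.map_congr rfl fun a ha => congrArg (cls F hF) (hA' a ha),
    Multiset.map_congr rfl fun a ha => congrArg (cls F hF) (hB' a ha), mul_right_comm]

/-- The central criterion. Factors of `t` cannot split under a substitution, whereas a variable of
`s` may expand to several factors. A matching of `s` into `t` together with the cardinality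
inequality is a perfect matching. -/
theorem unif_iff_matches (hn : (vars s + vars t).Nodup) (hy : ∀ y, .var y ∉ flat F.1 t) :
    Unif s t ↔ ((∃ x, .var x ∈ flat F.1 s) ∨ (flat F.1 t).card ≤ (flat F.1 s).card) ∧
      Matches Unif (flat F.1 s) (flat F.1 t) := by
  have hs := sum_vars_flat F s
  have ht := sum_vars_flat F t
  constructor
  · rintro ⟨σ, hσ⟩
    have h := map_acClass_flat_eq hF hσ hσ.similar
    rw [flat_subst, flat_subst, Multiset.bind_congr (f := fun a => flat F.1 (a.subst σ))
      (g := fun a => {a.subst σ}) (m := flat F.1 t) fun b hb => flat_subst_of_mem F hb σ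
        fun y h => hy y (h ▸ hb), Multiset.bind_singleton, Multiset.map_map,
      Multiset.map_bind] at h
    constructor
    · by_contra! hc
      obtain ⟨hx, hc⟩ := hc
      -- Without variables in `s` its factors do not split either, so both sides have equally many
      -- factors.
      rw [Multiset.bind_congr (f := fun a => (flat F.1 (a.subst σ)).map acClass)
        (g := fun a => {acClass (a.subst σ)}) (m := flat F.1 s) fun b hb => by
          rw [flat_subst_of_mem F hb σ fun y h => hx y (h ▸ hb), Multiset.map_singleton],
        Multiset.bind_singleton] at h
      have := congrArg Multiset.card h
      simp only [Multiset.card_map] at this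
      omega
    -- Each factor `a` of `s` contributes a nonempty multiset of factors of the common instance, and
    -- every one of these comes from a factor of `t`.
    · obtain ⟨B, hB, hr⟩ := matches_of_bind_le
        (fun a _ h => flat_ne_zero F (a.subst σ) (Multiset.map_eq_zero.1 h)) h.le
      refine ⟨B, hB, hr.mono fun a ha b hb hab => ?_⟩
      cases a with
      | var x =>
        refine unif_var_left fun hx => ?_
        refine notMem_of_nodup_add hn (x := x) ?_ ?_
        · rw [← hs]
          exact Multiset.mem_of_le (Multiset.single_le_sum (fun _ _ => Multiset.zero_le _) _
            (Multiset.mem_map_of_mem _ ha)) (by simp [vars])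
        · rw [← ht]
          exact Multiset.mem_of_le (Multiset.single_le_sum (fun _ _ => Multiset.zero_le _) _
            (Multiset.mem_map_of_mem _ (Multiset.mem_of_le hB hb))) hx
      | func g ts =>
        rw [flat_subst_of_mem F ha σ (by simp), Multiset.map_singleton,
          Multiset.mem_singleton] at hab
        exact ⟨σ, acClass_eq.1 hab.symm⟩
  · rintro ⟨h, B, hB, hr⟩
    rw [← hs, ← ht] at hn
    by_cases hc : (flat F.1 t).card ≤ (flat F.1 s).card
    · rw [Multiset.card_eq_card_of_rel hr] at hc
      obtain rfl := Multiset.eq_of_le_of_card_le hB hc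
      obtain ⟨σ, hσ⟩ := unif_of_rel hF hr hn
      exact ⟨σ, (cls_inj F hF).1 (by rw [cls_subst, cls_subst, hσ])⟩
    · obtain ⟨x, hx⟩ := h.resolve_right hc
      obtain ⟨A, hA⟩ := Multiset.exists_cons_of_mem hx
      rw [hA, Multiset.rel_cons_left] at hr
      obtain ⟨b, B, -, hr, rfl⟩ := hr
      -- `C` consists of the unmatched factors of `t`; the variable `x` takes them together with its
      -- own partner `b`, as the single term `u`.
      obtain ⟨C, hC⟩ := Multiset.le_iff_exists_add.1 hB
      obtain ⟨u, hu, hv⟩ := exists_product F hF C b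
      have e : ((u ::ₘ B).map vars).sum = ((flat F.1 t).map vars).sum := by
        simp only [hC, Multiset.map_cons, Multiset.sum_cons, hv, Multiset.map_add,
          Multiset.sum_add, Multiset.cons_add]
        abel
      rw [← e, hA] at hn
      have hxu : x ∉ vars u := fun h => by
        refine notMem_of_nodup_add hn (x := x) ?_ ?_
        · simp [vars]
        · simp [h]
      obtain ⟨σ, hσ⟩ := unif_of_rel hF (.cons (unif_var_left hxu) hr) hn
      refine ⟨σ, (cls_inj F hF).1 ?_⟩
      rw [cls_subst, cls_subst, hA, hσ, hC]
      simp only [Multiset.map_cons, Multiset.prod_cons, hu, Multiset.map_add, Multiset.prod_add,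
        Multiset.cons_add]
      ac_rfl

end ac

end ACSignature

/-! ### Bipartite matching by an auction -/

/-- A column of the assignment problem that the auction solves: a column, its price and the row
that owns it. -/
abbrev Column (α β : Type) : Type := β × ℕ × Option α

namespace Auction

open ACSignature (Matches)

variable {α β : Type} (r : α → β → Bool)

/-- One step of the search for the cheapest column that the row `a` accepts. -/
def pick (a : α) (s : Option (Column α β) × List (Column α β)) (c : Column α β) :
    Option (Column α β) × List (Column α β) :=
  match s.1 with
  | none => bif r a c.1 then (some c, s.2) else (none, c :: s.2)
  | some d => bif r a c.1 && decide (c.2.1 < d.2.1) then (some c, d :: s.2) else (some d, c :: s.2)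

/-- The cheapest column that the row `a` accepts, and the remaining columns. -/
def extract (a : α) (cols : List (Column α β)) : Option (Column α β) × List (Column α β) :=
  cols.foldl (pick r a) (none, [])

/-- The first row of the queue buys the cheapest column that it accepts, if this does not cost
more than `N`, and raises its price. The previous owner goes back to the queue. -/
def round (N : ℕ) (s : List α × List (Column α β)) : List α × List (Column α β) :=
  match s.1 with
  | [] => s
  | a :: q =>
    match (extract r a s.2).1 with
    | none => s
    | some d =>
      bif decide (d.2.1 ≤ N) then
        (d.2.2.toList ++ q, (d.1, d.2.1 + 1, some a) :: (extract r a s.2).2)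
      else s

/-- The auction decides whether all the rows can be assigned to different columns. -/
def assignable (A : List α) (B : List β) : Bool :=
  ((round r A.length)^[B.length * (A.length + 1) + 1] (A, B.map fun b => (b, 0, none))).1.isEmpty

/-- The state of the search for the cheapest column is correct. -/
def Cheapest (a : α) (s : Option (Column α β) × List (Column α β)) : Prop :=
  match s.1 with
  | none => ∀ c ∈ s.2, r a c.1 = false
  | some d => r a d.1 = true ∧ ∀ c ∈ s.2, r a c.1 = true → d.2.1 ≤ c.2.1

variable {r}

theorem pick_spec {a : α} {s : Option (Column α β) × List (Column α β)} (h : Cheapest r a s)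
    (c : Column α β) : Cheapest r a (pick r a s c) ∧
      ((pick r a s c).1.toList ++ (pick r a s c).2).Perm (c :: (s.1.toList ++ s.2)) := by
  obtain ⟨_ | d, l⟩ := s
  · simp only [Cheapest] at h
    cases hc : r a c.1
    · simp_all [pick, Cheapest, -Prod.forall]
    · simp_all [pick, Cheapest, -Prod.forall]
  · simp only [Cheapest] at h
    obtain ⟨h₁, h₂⟩ := h
    cases hc : r a c.1
    · simp_all [pick, Cheapest, List.Perm.swap, -Prod.forall]
    · by_cases hlt : c.2.1 < d.2.1
      · simp only [pick, hc, hlt, decide_true, Bool.and_self, cond_true, Cheapest]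
        refine ⟨⟨trivial, ?_⟩, by simp⟩
        intro e he hre
        rcases List.mem_cons.1 he with rfl | he
        · exact hlt.le
        · exact hlt.le.trans (h₂ e he hre)
      · simp only [pick, hc, hlt, decide_false, Bool.and_false, cond_false, Cheapest]
        refine ⟨⟨h₁, ?_⟩, by simpa using List.Perm.swap _ _ _⟩
        intro e he hre
        rcases List.mem_cons.1 he with rfl | he
        · exact not_lt.1 hlt
        · exact h₂ e he hre

theorem foldl_pick_spec {a : α} (cols : List (Column α β))
    {s : Option (Column α β) × List (Column α β)} (h : Cheapest r a s) :
    Cheapest r a (cols.foldl (pick r a) s) ∧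
      ((cols.foldl (pick r a) s).1.toList ++ (cols.foldl (pick r a) s).2).Perm
        (cols ++ (s.1.toList ++ s.2)) := by
  induction cols generalizing s with
  | nil => exact ⟨h, .refl _⟩
  | cons c cols ih =>
    obtain ⟨h₁, h₂⟩ := pick_spec h c
    obtain ⟨h₃, h₄⟩ := ih h₁
    exact ⟨h₃, h₄.trans ((h₂.append_left cols).trans List.perm_middle)⟩

theorem extract_spec (r : α → β → Bool) (a : α) (cols : List (Column α β)) :
    Cheapest r a (extract r a cols) ∧
      ((extract r a cols).1.toList ++ (extract r a cols).2).Perm cols := by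
  simpa [extract] using foldl_pick_spec (s := (none, [])) cols (by simp [Cheapest])

/-- The rows that own a column. -/
def owners (C : Multiset (Column α β)) : Multiset α := C.filterMap fun c => c.2.2

/-- The invariant of the auction. -/
structure Invariant (r : α → β → Bool) (A : Multiset α) (B : Multiset β) (N : ℕ) (q : Multiset α)
    (C : Multiset (Column α β)) : Prop where
  rows : q + owners C = A
  cols : C.map (·.1) = B
  free : ∀ c ∈ C, c.2.2 = none → c.2.1 = 0
  price_le : ∀ c ∈ C, c.2.1 ≤ N + 1
  accepted : ∀ c ∈ C, ∀ a, c.2.2 = some a → r a c.1 = true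
  cheap : ∀ c ∈ C, ∀ a, c.2.2 = some a → ∀ d ∈ C, r a d.1 = true → c.2.1 ≤ d.2.1 + 1

variable {A : Multiset α} {B : Multiset β} {N : ℕ}

theorem owners_cons (c : Column α β) (C : Multiset (Column α β)) :
    owners (c ::ₘ C) = (c.2.2.toList : Multiset α) + owners C := by
  obtain ⟨b, p, _ | a⟩ := c
  · simp [owners]
  · simp [owners]

/-- The clause `cheap` survives because the buyer took a cheapest acceptable column, whose price
rises by just one, while for every other owner prices elsewhere can only have risen. -/
theorem Invariant.next {q : Multiset α} {C : Multiset (Column α β)} {a : α} {d : Column α β}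
    (h : Invariant r A B N (a ::ₘ q) (d ::ₘ C)) (ha : r a d.1 = true)
    (hd : ∀ c ∈ C, r a c.1 = true → d.2.1 ≤ c.2.1) (hN : d.2.1 ≤ N) :
    Invariant r A B N (d.2.2.toList + q) ((d.1, d.2.1 + 1, some a) ::ₘ C) where
  rows := by
    rw [← h.rows, owners_cons, owners_cons]
    simp only [Option.toList_some, Multiset.coe_singleton, Multiset.singleton_add,
      Multiset.cons_add, Multiset.add_cons]
    congr 1
    abel
  cols := by
    rw [← h.cols]
    simp
  free c hc hc' := by
    rcases Multiset.mem_cons.1 hc with rfl | hc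
    · simp at hc'
    · exact h.free c (Multiset.mem_cons_of_mem hc) hc'
  price_le c hc := by
    rcases Multiset.mem_cons.1 hc with rfl | hc
    · simpa using hN
    · exact h.price_le c (Multiset.mem_cons_of_mem hc)
  accepted c hc a' hc' := by
    rcases Multiset.mem_cons.1 hc with rfl | hc
    · cases hc'; exact ha
    · exact h.accepted c (Multiset.mem_cons_of_mem hc) a' hc'
  cheap c hc a' hc' e he hr := by
    rcases Multiset.mem_cons.1 hc with rfl | hc
    · cases hc'
      rcases Multiset.mem_cons.1 he with rfl | he
      · exact Nat.le_succ _
      · exact Nat.succ_le_succ (hd e he hr)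
    · rcases Multiset.mem_cons.1 he with rfl | he
      · exact (h.cheap c (Multiset.mem_cons_of_mem hc) a' hc' d (Multiset.mem_cons_self _ _)
          hr).trans (by simp)
      · exact h.cheap c (Multiset.mem_cons_of_mem hc) a' hc' e (Multiset.mem_cons_of_mem he) hr

theorem Invariant.matches {C : Multiset (Column α β)} (h : Invariant r A B N 0 C) :
    Matches (fun a b => r a b = true) A B := by
  obtain ⟨rfl, rfl, -, -, h, -⟩ := h
  rw [zero_add]
  induction C using Multiset.induction_on with
  | empty => exact ⟨0, le_rfl, .zero⟩
  | cons c C ih =>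
    obtain ⟨B', hB', hr⟩ := ih fun c hc => h c (Multiset.mem_cons_of_mem hc)
    rw [owners_cons, Multiset.map_cons]
    rcases ho : c.2.2 with _ | a
    · exact ⟨B', hB'.trans (Multiset.le_cons_self _ _), by simpa using hr⟩
    · exact ⟨c.1 ::ₘ B', Multiset.cons_le_cons _ hB',
        by simpa using .cons (h c (Multiset.mem_cons_self _ _) a ho) hr⟩

theorem _root_.ACSignature.Matches.of_le {r : α → β → Prop} {A' : Multiset α}
    (h : Matches r A B) (hA : A' ≤ A) : Matches r A' B := by
  obtain ⟨C, rfl⟩ := Multiset.le_iff_exists_add.1 hA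
  obtain ⟨B', hB, hr⟩ := h
  obtain ⟨B₁, B₂, h₁, -, rfl⟩ := Multiset.rel_add_left.1 hr
  exact ⟨B₁, (Multiset.le_add_right _ _).trans hB, h₁⟩

/-- The necessary half of Hall's condition. -/
theorem _root_.ACSignature.Matches.card_le {r : α → β → Prop} (h : Matches r A B)
    (P : β → Prop) [DecidablePred P] (hP : ∀ a ∈ A, ∀ b ∈ B, r a b → P b) :
    A.card ≤ (B.filter P).card := by
  obtain ⟨B', hB, hr⟩ := h
  rw [Multiset.card_eq_card_of_rel hr]
  refine Multiset.card_le_card (Multiset.le_filter.2 ⟨hB, fun b hb => ?_⟩)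
  obtain ⟨a, ha, hab⟩ := Multiset.exists_mem_of_rel_of_mem (Multiset.rel_flip.2 hr) hb
  exact hP a ha b (Multiset.mem_of_le hB hb) hab

theorem owners_le_of_le {C D : Multiset (Column α β)} (h : C ≤ D) : owners C ≤ owners D :=
  Multiset.filterMap_le_filterMap _ h

theorem card_owners {C : Multiset (Column α β)} (h : ∀ c ∈ C, c.2.2 ≠ none) :
    (owners C).card = C.card := by
  induction C using Multiset.induction_on with
  | empty => rfl
  | cons c C ih =>
    rw [owners_cons, Multiset.card_add, ih fun c hc => h c (Multiset.mem_cons_of_mem hc)]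
    obtain ⟨a, ha⟩ := Option.ne_none_iff_exists'.1 (h c (Multiset.mem_cons_self _ _))
    simp [ha, add_comm]

/-- If the rows can be assigned to different columns, no row finds all the columns that it accepts
too expensive. -/
theorem Invariant.exists_cheap {q : Multiset α} {C : Multiset (Column α β)} {a : α}
    (h : Invariant r A B A.card (a ::ₘ q) C) (hm : Matches (fun a b => r a b = true) A B) :
    ∃ c ∈ C, r a c.1 = true ∧ c.2.1 ≤ A.card := by
  classical
  by_contra! hc
  let D := C.filter fun c => c.2.2 ≠ none
  -- Pigeonhole: there are `A.card` price levels but fewer owned columns, as `a` is still waiting;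
  -- so some level `l` is the price of no owned column. Unowned columns cost `0`, hence no column at
  -- all has price `l`.
  obtain ⟨l, hl, hl'⟩ : ∃ l ∈ Finset.Icc 1 A.card, l ∉ (D.map fun c => c.2.1).toFinset := by
    by_contra! hsub
    have h₁ := Finset.card_le_card (show Finset.Icc 1 A.card ⊆ _ from hsub)
    have h₂ := Multiset.toFinset_card_le (D.map fun c => c.2.1)
    have h₃ : D.card = (owners D).card := (card_owners fun c hc => (Multiset.mem_filter.1 hc).2).symm
    have h₄ := Multiset.card_le_card (owners_le_of_le (Multiset.filter_le (fun c => c.2.2 ≠ none) C))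
    have h₅ := congrArg Multiset.card h.rows
    rw [Nat.card_Icc] at h₁
    rw [Multiset.card_map] at h₂
    rw [Multiset.card_add, Multiset.card_cons] at h₅
    simp only [D] at *
    omega
  have hne : ∀ c ∈ C, c.2.1 ≠ l := by
    intro c hc' e
    by_cases ho : c.2.2 = none
    · have := h.free c hc' ho
      have := (Finset.mem_Icc.1 hl).1
      omega
    · exact hl' (Multiset.mem_toFinset.2 (Multiset.mem_map.2
        ⟨c, Multiset.mem_filter.2 ⟨hc', ho⟩, e⟩))
  -- The rows that own a column above the gap, together with `a`, accept only columns above the gap: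
  -- by `cheap` an owner in `E` accepts nothing below price `l`, and price `l` itself does not
  -- occur. These are `E.card + 1` rows for `E.card` columns, against Hall's condition.
  let E := C.filter fun c => l < c.2.1
  have hE : (owners E).card = E.card := card_owners fun c hc' ho => by
    have := h.free c (Multiset.mem_filter.1 hc').1 ho
    have := (Multiset.mem_filter.1 hc').2
    omega
  have hle : a ::ₘ owners E ≤ A := by
    rw [← h.rows, Multiset.cons_add]
    exact Multiset.cons_le_cons _ ((owners_le_of_le (Multiset.filter_le _ C)).trans
      (Multiset.le_add_left _ _))
  have h₁ := (hm.of_le hle).card_le (fun b => ∃ t ∈ a ::ₘ owners E, r t b = true)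
    fun t ht b _ hr => ⟨t, ht, hr⟩
  rw [← h.cols, Multiset.filter_map, Multiset.card_map, Multiset.card_cons, hE] at h₁
  refine absurd h₁ (not_le.2 (Nat.lt_succ_of_le (Multiset.card_le_card
    (Multiset.le_filter.2 ⟨Multiset.filter_le _ _, fun c hc' => ?_⟩))))
  obtain ⟨hcC, t, ht, hr⟩ := Multiset.mem_filter.1 hc'
  rcases Multiset.mem_cons.1 ht with rfl | ht
  · have := hc c hcC hr
    have := (Finset.mem_Icc.1 hl).2
    omega
  · obtain ⟨e, he, het⟩ := (Multiset.mem_filterMap _ _).1 ht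
    obtain ⟨heC, hle⟩ := Multiset.mem_filter.1 he
    have h₂ := h.cheap e heC t het c hcC hr
    have h₃ := hne c hcC
    omega

theorem Invariant.round {s : List α × List (Column α β)} (h : Invariant r A B N s.1 s.2) :
    Invariant r A B N (round r N s).1 (round r N s).2 := by
  obtain ⟨_ | ⟨a, q⟩, C⟩ := s
  · exact h
  · obtain ⟨h₁, h₂⟩ := extract_spec r a C
    rcases he : extract r a C with ⟨_ | d, D⟩
    · simpa [Auction.round, he] using h
    · simp only [he, Cheapest, Option.toList_some, List.singleton_append] at h₁ h₂
      by_cases hN : d.2.1 ≤ N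
      · simp only [Auction.round, he, hN, decide_true, cond_true]
        rw [← Multiset.coe_eq_coe.2 h₂] at h
        exact Invariant.next (q := q) (C := D) h h₁.1 h₁.2 hN
      · simpa [Auction.round, he, hN] using h

/-- The sum of all prices. -/
def total (C : List (Column α β)) : ℕ := (C.map fun c => c.2.1).sum

/-- The sum of the prices measures progress: if a matching exists, the first row of the queue always
finds an affordable column. -/
theorem total_round {s : List α × List (Column α β)} (h : Invariant r A B A.card s.1 s.2)
    (hm : Matches (fun a b => r a b = true) A B) (hs : s.1 ≠ []) :
    total (round r A.card s).2 = total s.2 + 1 := by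
  obtain ⟨_ | ⟨a, q⟩, C⟩ := s
  · exact absurd rfl hs
  · obtain ⟨h₁, h₂⟩ := extract_spec r a C
    obtain ⟨c, hc, hr, hN⟩ := Invariant.exists_cheap (q := q) (C := C) (a := a) h hm
    have hc' := h₂.mem_iff.2 (Multiset.mem_coe.1 hc)
    rcases he : extract r a C with ⟨_ | d, D⟩
    · simp only [he, Cheapest, Option.toList_none, List.nil_append] at h₁ hc'
      simp [h₁ c hc'] at hr
    · simp only [he, Cheapest, Option.toList_some, List.singleton_append] at h₁ h₂ hc'
      have hN : d.2.1 ≤ A.card := by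
        rcases List.mem_cons.1 hc' with rfl | hc'
        · exact hN
        · exact (h₁.2 c hc' hr).trans hN
      simp only [Auction.round, he, hN, decide_true, cond_true]
      have := (h₂.map fun c => c.2.1).sum_eq
      simp only [total, ← this, List.map_cons, List.sum_cons]
      omega

theorem total_le {q : Multiset α} {C : List (Column α β)} (h : Invariant r A B N q C) :
    total C ≤ B.card * (N + 1) := by
  rw [← h.cols, Multiset.card_map, Multiset.coe_card, total]
  have := List.sum_le_card_nsmul (C.map fun c => c.2.1) (N + 1) fun x hx => by
    obtain ⟨c, hc, rfl⟩ := List.mem_map.1 hx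
    exact h.price_le c hc
  simpa using this

/-- An empty queue yields a matching from the owners. Conversely, if a matching exists and the queue
never becomes empty, the total price equals the number of rounds, which is chosen one larger than
`total_le` permits. -/
theorem assignable_iff {A : List α} {B : List β} :
    assignable r A B = true ↔ Matches (fun a b => r a b = true) (A : Multiset α) (B : Multiset β) := by
  let s₀ : List α × List (Column α β) := (A, B.map fun b => (b, 0, none))
  have hi : ∀ k, Invariant r A B A.length ((round r A.length)^[k] s₀).1
      ((round r A.length)^[k] s₀).2 := by
    intro k
    induction k with
    | zero =>
      refine ⟨?_, ?_, ?_, ?_, ?_, ?_⟩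
      · simp [s₀, owners]
      · simp [s₀, Function.comp_def]
      all_goals simp +contextual [s₀]
    | succ k ih => rw [Function.iterate_succ_apply']; exact ih.round
  rw [assignable, List.isEmpty_iff]
  constructor
  · intro h
    have := hi (B.length * (A.length + 1) + 1)
    rw [h] at this
    exact this.matches
  · intro hm
    have key : ∀ k, ((round r A.length)^[k] s₀).1 = [] ∨
        total ((round r A.length)^[k] s₀).2 = k := by
      intro k
      induction k with
      | zero => right; simp [s₀, total, Function.comp_def]
      | succ k ih =>
        rw [Function.iterate_succ_apply']
        by_cases hs : ((round r A.length)^[k] s₀).1 = []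
        · left
          rw [Auction.round, hs]
          exact hs
        · right
          have := total_round (hi k) hm hs
          rw [Multiset.coe_card] at this
          rw [this, ih.resolve_left hs]
    refine (key _).resolve_right fun h => ?_
    have := total_le (hi (B.length * (A.length + 1) + 1))
    rw [Multiset.coe_card] at this
    omega

end Auction

/-! ### Parsing the input into flattened trees -/

/-- The number of a token. -/
def TermToken.toNat : TermToken → ℕ
  | .variableTag => 0
  | .freeTag => 1
  | .acTag => 2
  | .openParen => 3
  | .closeParen => 4
  | .comma => 5
  | .bit false => 6
  | .bit true => 7

instance : TreeRep TermToken :=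
  ⟨fun k => rep k.toNat, fun a b h => by
    have := TreeRep.rep_injective h
    revert a b
    decide⟩

section

variable {α β γ : Type} [TreeRep α] [TreeRep β] [TreeRep γ]

theorem PT.decide_eq_of_rep [DecidableEq α] {f g : γ → α} (hf : PT f) (hg : PT g) :
    PT fun x => decide (f x = g x) :=
  (hf.rep.decide_eq hg.rep).congr fun x => by
    rw [Bool.eq_iff_iff]
    simp [TreeRep.rep_injective.eq_iff]

theorem PT.tokenCases {k : γ → TermToken} {g : TermToken → γ → β} (hk : PT k)
    (hg : ∀ c, PT (g c)) : PT fun x => g (k x) x := by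
  have h := fun c => hk.decide_eq_of_rep (PT.const c)
  refine PT.congr ((h .variableTag).cond (hg .variableTag) ((h .freeTag).cond (hg .freeTag)
    ((h .acTag).cond (hg .acTag) ((h .openParen).cond (hg .openParen)
    ((h .closeParen).cond (hg .closeParen) ((h .comma).cond (hg .comma)
    ((h (.bit false)).cond (hg (.bit false)) (hg (.bit true))))))))) fun x => ?_
  generalize k x = c
  cases c with
  | bit b => cases b <;> rfl
  | _ => rfl

end

namespace BinTree

/-- The list of the entries of a tree that represents a list. -/
def toList : BinTree → List BinTree
  | leaf => []
  | node a b => a :: toList b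

theorem toList_ofList (l : List BinTree) : (ofList l).toList = l := by
  induction l with
  | nil => rfl
  | cons a l ih => simp [ofList, toList, ih]

theorem rep_toList (t : BinTree) : rep t.toList = t := by
  induction t with
  | leaf => rfl
  | node a b _ ih => rw [toList, rep_cons, ih]; rfl

theorem toList_rep (l : List BinTree) : (rep l).toList = l := by
  have : rep l = ofList l := by
    change ofList (l.map id) = _
    rw [List.map_id]
  rw [this, toList_ofList]

theorem sz_toList (t : BinTree) : sz t.toList = sz t := by
  rw [sz, rep_toList]; rfl

/-- Whether a tree is a leaf. -/
def isLeaf : BinTree → Bool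
  | leaf => true
  | node _ _ => false

/-- The arguments of a term with the head `lab`, and the term itself otherwise. -/
def splice (lab : BinTree) : BinTree → List BinTree
  | leaf => [leaf]
  | node l r => bif decide (l = lab) then r.toList else [node l r]

/-- The tree of a compound term; products are flattened. -/
def build (ac : Bool) (name : List Bool) (args : List BinTree) : BinTree :=
  node (node (rep ac) (rep name))
    (rep (bif ac then args.flatMap (splice (node (rep ac) (rep name))) else args))

/-- Splicing removes the node and the label of a nested product and adds nothing. Hence one token
enlarges the state of the parser by a constant only. -/
theorem sz_flatMap_splice_le (lab : BinTree) (l : List BinTree) :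
    sz (l.flatMap (splice lab)) ≤ sz l := by
  induction l with
  | nil => rfl
  | cons t l ih =>
    have h := sz_append (splice lab t) (l.flatMap (splice lab))
    have : sz (splice lab t) ≤ sz t + 2 := by
      cases t with
      | leaf => simp [splice]
      | node a b =>
        by_cases hl : a = lab
        · simp [splice, hl, sz_toList]; omega
        · simp [splice, hl]
    rw [List.flatMap_cons, sz_cons]
    omega

end BinTree

open BinTree

@[fun_prop]
theorem PT.toList {γ : Type} [TreeRep γ] {f : γ → BinTree} (hf : PT f) :
    PT fun x => (f x).toList := .of_rep (hf.congr fun x => (rep_toList (f x)).symm)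

@[fun_prop]
theorem PT.isLeaf {γ : Type} [TreeRep γ] {f : γ → BinTree} (hf : PT f) :
    PT fun x => (f x).isLeaf :=
  (PT.treeCases (g := fun _ _ _ => false) hf (PT.const true) (by fun_prop)).congr fun x => by
    cases f x <;> rfl

@[fun_prop]
theorem PT.splice {γ : Type} [TreeRep γ] {f g : γ → BinTree} (hf : PT f) (hg : PT g) :
    PT fun x => BinTree.splice (f x) (g x) :=
  (PT.treeCases (f := fun _ => [BinTree.leaf])
    (g := fun x l r => bif decide (l = f x) then r.toList else [BinTree.node l r]) hg (by fun_prop)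
    (by fun_prop)).congr fun x => by cases g x <;> rfl

@[fun_prop]
theorem PT.build {γ : Type} [TreeRep γ] {ac : γ → Bool} {n : γ → List Bool}
    {l : γ → List BinTree} (hac : PT ac) (hn : PT n) (hl : PT l) :
    PT fun x => BinTree.build (ac x) (n x) (l x) := by
  have h₁ := hac.rep
  have h₂ := hn.rep
  have h₃ : PT fun x => bif ac x then (l x).flatMap
    (BinTree.splice (BinTree.node (TreeRep.rep (ac x)) (TreeRep.rep (n x)))) else l x :=
    hac.cond (PT.flatMap (f := fun x t => BinTree.splice
      (BinTree.node (TreeRep.rep (ac x)) (TreeRep.rep (n x))) t) (((h₁.node h₂).comp PT.fst').splice PT.snd') hl) hl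
  exact (h₁.node h₂).node h₃.rep

namespace TermToken

/-- The state of the parser: the bits of a name that were read, and for every open pair of
parentheses the terms that were read inside. -/
abbrev ParserState : Type := List Bool × List (List BinTree)

/-- Put a term in the innermost open pair of parentheses. -/
def attach (t : BinTree) : List (List BinTree) → List (List BinTree)
  | [] => []
  | l :: ls => (t :: l) :: ls

/-- Close the innermost pair of parentheses and make a compound term of its contents. -/
def reduce (ac : Bool) (s : ParserState) : ParserState :=
  match s.2 with
  | [] => s
  | l :: ls => ([], attach (build ac s.1 l) ls)

/-- The parser, which reads from right to left. -/
def parseToken (k : TermToken) (s : ParserState) : ParserState :=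
  match k with
  | .variableTag => ([], attach leaf s.2)
  | .freeTag => reduce false s
  | .acTag => reduce true s
  | .openParen => s
  | .closeParen => (s.1, [] :: s.2)
  | .comma => s
  | .bit b => (b :: s.1, s.2)

/-- The list of the terms that a word describes. -/
def parse (w : List TermToken) : List BinTree :=
  match (w.foldr parseToken ([], [[]])).2 with
  | [] => []
  | l :: _ => l

end TermToken

open TermToken

@[fun_prop]
theorem PT.attach {γ : Type} [TreeRep γ] {f : γ → BinTree} {g : γ → List (List BinTree)}
    (hf : PT f) (hg : PT g) : PT fun x => TermToken.attach (f x) (g x) :=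
  (PT.listCases (f := fun _ => []) (g := fun x l ls => (f x :: l) :: ls) hg (by fun_prop)
    (by fun_prop)).congr fun x => by cases g x <;> rfl

@[fun_prop]
theorem PT.reduce {γ : Type} [TreeRep γ] (ac : Bool) {f : γ → ParserState} (hf : PT f) :
    PT fun x => TermToken.reduce ac (f x) :=
  (PT.listCases (l := fun x => (f x).2) (f := fun x => f x)
    (g := fun x l ls => ([], TermToken.attach (BinTree.build ac (f x).1 l) ls)) (by fun_prop)
    (by fun_prop) (by fun_prop)).congr fun x => by
      unfold TermToken.reduce
      rcases (f x).2 with _ | ⟨l, ls⟩ <;> rfl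

theorem sz_attach_le (t : BinTree) (l : List (List BinTree)) :
    sz (TermToken.attach t l) ≤ sz l + sz t + 1 := by
  cases l <;> simp [TermToken.attach]; omega

theorem sz_reduce_le (ac : Bool) (s : ParserState) : sz (TermToken.reduce ac s) ≤ sz s + 10 := by
  obtain ⟨bits, _ | ⟨l, ls⟩⟩ := s
  · simp [TermToken.reduce]
  · have h₁ := sz_attach_le (BinTree.build ac bits l) ls
    have h₂ := sz_flatMap_splice_le (node (rep ac) (rep bits)) l
    have h₃ := sz_bool_le ac
    have h₄ : sz (BinTree.build ac bits l) ≤ sz ac + sz bits + sz l + 2 := by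
      have e : sz (BinTree.build ac bits l) = sz ac + sz bits + 1 + sz (bif ac then
        l.flatMap (BinTree.splice (node (rep ac) (rep bits))) else l) + 1 := by
        simp only [BinTree.build, sz_node]; rfl
      cases ac <;> simp only [cond_true, cond_false] at e <;> omega
    simp only [TermToken.reduce, sz_pair, sz_nil, sz_cons]
    omega

theorem sz_parseToken_le (k : TermToken) (s : ParserState) :
    sz (parseToken k s) ≤ sz s + 10 := by
  obtain ⟨bits, l⟩ := s
  cases k with
  | variableTag =>
    have := sz_attach_le leaf l
    have := sz_pos bits
    simp only [parseToken, sz_pair, sz_nil, sz_leaf] at *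
    omega
  | freeTag => exact sz_reduce_le _ _
  | acTag => exact sz_reduce_le _ _
  | bit b =>
    have := sz_bool_le b
    simp only [parseToken, sz_pair, sz_cons]
    omega
  | closeParen => simp [parseToken]; omega
  | openParen => simp [parseToken]
  | comma => simp [parseToken]

theorem PT.parse : PT TermToken.parse := by
  have h : PT fun w : List TermToken => w.foldr parseToken ([], [[]]) := by
    refine PT.foldr_of_le (f := fun _ => parseToken) (B := fun _ => 10) ?_ (by fun_prop)
      (by fun_prop) (by fun_prop) fun x s a _ => sz_parseToken_le a s
    refine PT.tokenCases (k := fun p : List TermToken × TermToken × ParserState => p.2.1)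
      (g := fun k p => parseToken k p.2.2) (by fun_prop) fun c => ?_
    cases c <;> simp only [parseToken] <;> fun_prop
  exact (PT.listCases (l := fun w => (w.foldr parseToken ([], [[]])).2) (f := fun _ => [])
    (g := fun _ l _ => l) (by fun_prop) (by fun_prop) (by fun_prop)).congr fun w => by
      unfold TermToken.parse
      rcases (w.foldr parseToken ([], [[]])).2 with _ | ⟨l, ls⟩ <;> rfl

/-! ### Enumeration of subtrees -/

namespace BinTree

/-- All subtrees of a tree. -/
def subs : BinTree → List BinTree
  | leaf => [leaf]
  | node a b => node a b :: (subs a ++ subs b)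

theorem self_mem_subs (t : BinTree) : t ∈ t.subs := by cases t <;> simp [subs]

theorem mem_subs_of_node_mem {a b t : BinTree} (h : node a b ∈ t.subs) :
    a ∈ t.subs ∧ b ∈ t.subs := by
  induction t with
  | leaf => simp [subs] at h
  | node c d ihc ihd =>
    simp only [subs, List.mem_cons, List.mem_append] at h ⊢
    rcases h with h | h | h
    · cases h; simp [self_mem_subs]
    · have := ihc h; tauto
    · have := ihd h; tauto

theorem mem_subs_of_mem_toList {a u t : BinTree} (h : u ∈ t.subs) (ha : a ∈ u.toList) :
    a ∈ t.subs := by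
  induction u with
  | leaf => simp [toList] at ha
  | node b c _ ih =>
    have hm := mem_subs_of_node_mem h
    rcases List.mem_cons.1 ha with rfl | ha
    · exact hm.1
    · exact ih hm.2 ha

/-- Read a symbol of the code of a tree, from right to left: the first component of the state is
the list of the trees that were read, the second one collects all subtrees. -/
def subsStep (b : Bool) (s : List BinTree × List BinTree) : List BinTree × List BinTree :=
  bif b then
    match s.1 with
    | [] => s
    | a :: l =>
      match l with
      | [] => s
      | c :: m => (node a c :: m, node a c :: s.2)
  else (leaf :: s.1, leaf :: s.2)

/-- Reading a prefix code from the right, both subtrees are on top of the list when the symbol of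
their node arrives; a single scan thus replaces the recursion. -/
theorem foldr_subsStep (t : BinTree) (s : List BinTree × List BinTree) :
    t.code.foldr subsStep s = (t :: s.1, t.subs ++ s.2) := by
  induction t generalizing s with
  | leaf => rfl
  | node a b iha ihb => simp [code, subs, ihb, iha, subsStep]

/-- Needed for arbitrary words, since the fold passes through suffixes that are not codes of trees.
Each step collects at most one tree, no larger than the list of trees that were read, whence a
quadratic bound. -/
theorem sz_subsStep_le (w : List Bool) : sz (w.foldr subsStep ([], [])).1 ≤ 2 * w.length + 1 ∧
    sz (w.foldr subsStep ([], [])).2 ≤ w.length * (2 * w.length + 4) + 1 := by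
  induction w with
  | nil => simp
  | cons b w ih =>
    rw [List.foldr_cons]
    generalize w.foldr subsStep ([], []) = s at ih
    have e : (w.length + 1) * (2 * (w.length + 1) + 4) =
      w.length * (2 * w.length + 4) + 4 * w.length + 6 := by ring
    rw [List.length_cons, e]
    obtain ⟨s, out⟩ := s
    simp only at ih
    obtain ⟨h₁, h₂⟩ := ih
    generalize w.length * (2 * w.length + 4) = X at *
    cases b with
    | false => simp [subsStep]; omega
    | true =>
      rcases s with _ | ⟨a, _ | ⟨c, m⟩⟩
      · simp [subsStep] at *; omega
      · simp [subsStep] at *; omega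
      · simp [subsStep] at *; omega

end BinTree

@[fun_prop]
theorem PT.subs {γ : Type} [TreeRep γ] {f : γ → BinTree} (hf : PT f) : PT fun x => (f x).subs := by
  have h : PT fun x => (f x).code.foldr subsStep ([], []) := by
    refine PT.foldr (f := fun _ => subsStep)
      (B := fun x => 2 * sz (f x) + 1 + (sz (f x) * (2 * sz (f x) + 4) + 1) + 1) ?_
      (by fun_prop) (by fun_prop) (by fun_prop) fun x k => ?_
    · refine PT.cond (by fun_prop) ?_ (by fun_prop)
      refine (PT.listCases (γ := γ × Bool × List BinTree × List BinTree) (l := fun p => p.2.2.1)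
        (f := fun p => p.2.2) (g := fun p a l => match l with
          | [] => p.2.2
          | c :: m => (BinTree.node a c :: m, BinTree.node a c :: p.2.2.2)) (by fun_prop) (by fun_prop) ?_).congr
        fun p => by obtain ⟨_, _, _ | ⟨_, _ | _⟩, _⟩ := p <;> rfl
      exact (PT.listCases
        (γ := (BinTree × List BinTree) × γ × Bool × List BinTree × List BinTree)
        (l := fun p => p.1.2) (f := fun p => p.2.2.2)
        (g := fun p c m => (BinTree.node p.1.1 c :: m, BinTree.node p.1.1 c :: p.2.2.2.2)) (by fun_prop)
        (by fun_prop) (by fun_prop)).congr fun p => by obtain ⟨⟨_, _ | _⟩, _⟩ := p <;> rfl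
    · obtain ⟨h₁, h₂⟩ := sz_subsStep_le ((f x).code.drop k)
      have : ((f x).code.drop k).length ≤ sz (f x) := by
        rw [List.length_drop]; exact Nat.sub_le _ _
      have h₃ : ((f x).code.drop k).length * (2 * ((f x).code.drop k).length + 4) ≤
        sz (f x) * (2 * sz (f x) + 4) := by gcongr
      rw [sz_pair]
      omega
  exact (PT.snd h).congr fun x => by rw [foldr_subsStep]; simp

/-! ### The auction runs in polynomial time -/

namespace Auction

variable {α β γ : Type} [TreeRep α] [TreeRep β] [TreeRep γ]

theorem pt_pick {r : γ → α → β → Bool} (hr : PT fun p : γ × α × β => r p.1 p.2.1 p.2.2) :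
    PT fun p : (γ × α) × (Option (Column α β) × List (Column α β)) × Column α β =>
      pick (r p.1.1) p.1.2 p.2.1 p.2.2 := by
  have h₁ : PT fun p : (γ × α) × (Option (Column α β) × List (Column α β)) × Column α β =>
    r p.1.1 p.1.2 p.2.2.1 := hr.comp (f := fun p : (γ × α) × (Option (Column α β) ×
      List (Column α β)) × Column α β => (p.1.1, p.1.2, p.2.2.1)) (by fun_prop)
  refine (PT.optionCases (l := fun p : (γ × α) × (Option (Column α β) × List (Column α β)) ×
      Column α β => p.2.1.1)
    (f := fun p => bif r p.1.1 p.1.2 p.2.2.1 then (some p.2.2, p.2.1.2)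
      else (none, p.2.2 :: p.2.1.2))
    (g := fun p d => bif r p.1.1 p.1.2 p.2.2.1 && decide (p.2.2.2.1 < d.2.1) then
        (some p.2.2, d :: p.2.1.2)
      else (some d, p.2.2 :: p.2.1.2)) (by fun_prop) (by fun_prop) ?_).congr fun p => by
    obtain ⟨_, ⟨_ | _, _⟩, _⟩ := p <;> rfl
  have h₂ : PT fun p : ((γ × α) × (Option (Column α β) × List (Column α β)) × Column α β) ×
      Column α β => r p.1.1.1 p.1.1.2 p.1.2.2.1 := h₁.comp PT.fst'
  fun_prop

theorem sz_pick_le {r : α → β → Bool} (a : α) (s : Option (Column α β) × List (Column α β))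
    (c : Column α β) : sz (pick r a s c) ≤ sz s + (sz c + 2) := by
  obtain ⟨_ | d, l⟩ := s
  · cases h : r a c.1 <;> simp [pick, h] <;> omega
  · cases h : r a c.1 && decide (c.2.1 < d.2.1) <;> simp only [pick, h, cond_true, cond_false,
      sz_pair, sz_cons, sz_some] <;> omega

theorem pt_extract {r : γ → α → β → Bool} (hr : PT fun p : γ × α × β => r p.1 p.2.1 p.2.2) :
    PT fun p : (γ × α) × List (Column α β) => extract (r p.1.1) p.1.2 p.2 := by
  refine PT.foldl_of_le (γ := (γ × α) × List (Column α β))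
    (f := fun p => pick (r p.1.1) p.1.2) (B := fun p => sz p.2 + 2)
    ((pt_pick hr).comp (f := fun p : ((γ × α) × List (Column α β)) ×
      (Option (Column α β) × List (Column α β)) × Column α β => (p.1.1, p.2)) (by fun_prop))
    (by fun_prop) (by fun_prop) (by fun_prop) fun p s c hc => ?_
  have := sz_le_of_mem hc
  have := sz_pick_le (r := r p.1.1) p.1.2 s c
  omega

theorem pt_round {r : γ → α → β → Bool} (hr : PT fun p : γ × α × β => r p.1 p.2.1 p.2.2) :
    PT fun p : (γ × ℕ) × List α × List (Column α β) => round (r p.1.1) p.1.2 p.2 := by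
  refine (PT.listCases (l := fun p : (γ × ℕ) × List α × List (Column α β) => p.2.1)
    (f := fun p => p.2) (g := fun p a q =>
      match (extract (r p.1.1) a p.2.2).1 with
      | none => p.2
      | some d =>
        bif decide (d.2.1 ≤ p.1.2) then
          (d.2.2.toList ++ q, (d.1, d.2.1 + 1, some a) :: (extract (r p.1.1) a p.2.2).2)
        else p.2) (by fun_prop) (by fun_prop) ?_).congr fun p => by
    obtain ⟨_, _ | ⟨a, q⟩, C⟩ := p <;> rfl
  have h : PT fun p : (α × List α) × (γ × ℕ) × List α × List (Column α β) =>
      extract (r p.2.1.1) p.1.1 p.2.2.2 := (pt_extract hr).comp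
    (f := fun p : (α × List α) × (γ × ℕ) × List α × List (Column α β) =>
      ((p.2.1.1, p.1.1), p.2.2.2)) (by fun_prop)
  refine (PT.optionCases (l := fun p : (α × List α) × (γ × ℕ) × List α × List (Column α β) =>
      (extract (r p.2.1.1) p.1.1 p.2.2.2).1) (f := fun p => p.2.2)
    (g := fun p d => bif decide (d.2.1 ≤ p.2.1.2) then
          (d.2.2.toList ++ p.1.2,
            (d.1, d.2.1 + 1, some p.1.1) :: (extract (r p.2.1.1) p.1.1 p.2.2.2).2)
        else p.2.2) (by fun_prop) (by fun_prop) ?_).congr fun p => by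
    rcases (extract (r p.2.1.1) p.1.1 p.2.2.2).1 <;> rfl
  have h' : PT fun p : ((α × List α) × (γ × ℕ) × List α × List (Column α β)) × Column α β =>
      extract (r p.1.2.1.1) p.1.1.1 p.1.2.2.2 := h.comp PT.fst'
  have ho : PT fun o : Option α => o.toList :=
    (PT.optionCases (l := fun o : Option α => o) (f := fun _ => []) (g := fun _ a => [a])
      (by fun_prop) (by fun_prop) (by fun_prop)).congr fun o => by cases o <;> rfl
  have ho' : PT fun p : ((α × List α) × (γ × ℕ) × List α × List (Column α β)) × Column α β =>
      p.2.2.2.toList := ho.comp (f := fun p : ((α × List α) × (γ × ℕ) × List α ×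
        List (Column α β)) × Column α β => p.2.2.2) (by fun_prop)
  fun_prop

theorem sz_perm {l m : List α} (h : l.Perm m) : sz l = sz m := by
  induction h with
  | nil => rfl
  | cons a _ ih => simp [ih]
  | swap a b l => simp; omega
  | trans _ _ ih ih' => exact ih.trans ih'

/-- Extraction only permutes the columns; the new price and the move of the two rows between queue
and columns cost a constant. -/
theorem sz_round_le (r : α → β → Bool) (N : ℕ) (s : List α × List (Column α β)) :
    sz (round r N s) ≤ sz s + 10 := by
  obtain ⟨_ | ⟨a, q⟩, C⟩ := s
  · simp [Auction.round]
  · obtain ⟨-, h⟩ := extract_spec r a C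
    rcases he : extract r a C with ⟨_ | d, D⟩
    · simp [Auction.round, he]
    · simp only [he, Option.toList_some, List.singleton_append] at h
      have h := sz_perm h
      by_cases hN : d.2.1 ≤ N
      · obtain ⟨b, p, _ | e⟩ := d
        · simp [Auction.round, he, hN] at *; omega
        · simp [Auction.round, he, hN] at *; omega
      · simp [Auction.round, he, hN]

theorem pt_assignable {r : γ → α → β → Bool} {A : γ → List α} {B : γ → List β}
    (hr : PT fun p : γ × α × β => r p.1 p.2.1 p.2.2) (hA : PT A) (hB : PT B) :
    PT fun x => assignable (r x) (A x) (B x) := by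
  have h : PT fun x => (round (r x) (A x).length)^[(B x).length * ((A x).length + 1) + 1]
      (A x, (B x).map fun b => ((b, 0, none) : Column α β)) := by
    have hm : PT fun x => (B x).map fun b => ((b, 0, none) : Column α β) := by fun_prop
    refine PT.iterate (f := fun x => round (r x) (A x).length)
      (B := fun x => sz (A x, (B x).map fun b => ((b, 0, none) : Column α β)) +
        sz ((B x).length * ((A x).length + 1) + 1) * 10)
      ((pt_round hr).comp (f := fun p : γ × List α × List (Column α β) =>
        ((p.1, (A p.1).length), p.2)) (by fun_prop)) (by fun_prop) (by fun_prop)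
      (by fun_prop) fun x k hk => ?_
    have key : ∀ k s, sz ((round (r x) (A x).length)^[k] s) ≤ sz s + k * 10 := by
      intro k s
      induction k with
      | zero => simp
      | succ k ih =>
        rw [Function.iterate_succ_apply']
        have := sz_round_le (r x) (A x).length ((round (r x) (A x).length)^[k] s)
        omega
    refine (key k _).trans ?_
    rw [sz_nat]
    omega
  exact (PT.listCases (l := fun x => ((round (r x) (A x).length)^[(B x).length *
    ((A x).length + 1) + 1] (A x, (B x).map fun b => ((b, 0, none) : Column α β))).1)
    (f := fun _ => true) (g := fun _ _ _ => false) (by fun_prop) (by fun_prop)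
    (by fun_prop)).congr fun x => by
      unfold assignable
      rcases ((round (r x) (A x).length)^[(B x).length * ((A x).length + 1) + 1]
        (A x, (B x).map fun b => (b, 0, none))).1 <;> rfl

end Auction

/-! ### The table of unifiable pairs and the algorithm -/

namespace BinTree

/-- Whether the pair of `a` and `b` is in the table. -/
def edge (tab : List BinTree) (a b : BinTree) : Bool := tab.any fun e => decide (e = node a b)

/-- Whether two flattened products are unifiable, unifiability of their arguments being given by
the table. -/
def checkAC (tab A B : List BinTree) : Bool :=
  bif A.any isLeaf then
    bif B.any isLeaf then true else Auction.assignable (edge tab) A B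
  else
    bif B.any isLeaf then Auction.assignable (fun b a => edge tab a b) B A
    else decide (B.length ≤ A.length) && Auction.assignable (edge tab) A B

/-- Whether a label belongs to an associative-commutative symbol. -/
def isACLabel : BinTree → Bool
  | leaf => false
  | node a _ => !a.isLeaf

/-- Whether two terms are unifiable, unifiability of their arguments being given by the table. -/
def check (tab : List BinTree) (s t : BinTree) : Bool :=
  match s with
  | leaf => true
  | node l as =>
    match t with
    | leaf => true
    | node m bs =>
      decide (l = m) && bif isACLabel l then checkAC tab as.toList bs.toList
        else (as.toList.zip bs.toList).all fun p => edge tab p.1 p.2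

/-- Whether the two components of a pair are unifiable, the table being given. -/
def checkPair (tab : List BinTree) (e : BinTree) : Bool :=
  match e with
  | leaf => false
  | node s t => check tab s t

/-- All pairs of elements of a list. -/
def pairs (L : List BinTree) : List BinTree := L.flatMap fun a => L.map fun b => node a b

/-- The table after `k` rounds. -/
def table (L : List BinTree) (k : ℕ) : List BinTree :=
  (fun tab => (pairs L).filter (checkPair tab))^[k] []

end BinTree

/-- The algorithm. -/
def unifiable (w : List TermToken) : Bool :=
  match parse w with
  | [] => false
  | s :: l =>
    match l with
    | [] => false
    | t :: _ => edge (table (node s t).subs (sz (node s t))) s t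

section

variable {γ : Type} [TreeRep γ]

@[fun_prop]
theorem PT.edge {t : γ → List BinTree} {a b : γ → BinTree} (ht : PT t) (ha : PT a) (hb : PT b) :
    PT fun x => BinTree.edge (t x) (a x) (b x) := by
  unfold BinTree.edge
  fun_prop

@[fun_prop]
theorem PT.checkAC {t A B : γ → List BinTree} (ht : PT t) (hA : PT A) (hB : PT B) :
    PT fun x => BinTree.checkAC (t x) (A x) (B x) := by
  have h₁ := Auction.pt_assignable (r := fun x a b => BinTree.edge (t x) a b) (by fun_prop) hA hB
  have h₂ := Auction.pt_assignable (r := fun x b a => BinTree.edge (t x) a b) (by fun_prop) hB hA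
  have h₃ : PT fun x => (A x).any BinTree.isLeaf := by fun_prop
  have h₄ : PT fun x => (B x).any BinTree.isLeaf := by fun_prop
  unfold BinTree.checkAC
  fun_prop

@[fun_prop]
theorem PT.isACLabel {f : γ → BinTree} (hf : PT f) : PT fun x => (f x).isACLabel :=
  (PT.treeCases (f := fun _ => false) (g := fun _ a _ => !a.isLeaf) hf (by fun_prop)
    (by fun_prop)).congr fun x => by cases f x <;> rfl

@[fun_prop]
theorem PT.check {tab : γ → List BinTree} {s t : γ → BinTree} (htab : PT tab) (hs : PT s)
    (ht : PT t) : PT fun x => BinTree.check (tab x) (s x) (t x) := by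
  refine (PT.treeCases hs (PT.const true) (g := fun x l as => match t x with
    | .leaf => true
    | .node m bs => decide (l = m) && bif l.isACLabel then
        BinTree.checkAC (tab x) as.toList bs.toList
        else (as.toList.zip bs.toList).all fun p => BinTree.edge (tab x) p.1 p.2) ?_).congr
    fun x => by rcases s x with _ | _ <;> rcases t x with _ | _ <;> rfl
  exact (PT.treeCases (γ := (BinTree × BinTree) × γ) (t := fun p => t p.2) (by fun_prop)
    (PT.const true) (g := fun p m bs => decide (p.1.1 = m) &&
      bif p.1.1.isACLabel then BinTree.checkAC (tab p.2) p.1.2.toList bs.toList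
        else (p.1.2.toList.zip bs.toList).all fun q => BinTree.edge (tab p.2) q.1 q.2)
    (by fun_prop)).congr fun x => by rcases t x.2 with _ | _ <;> rfl

@[fun_prop]
theorem PT.checkPair {tab : γ → List BinTree} {e : γ → BinTree} (htab : PT tab) (he : PT e) :
    PT fun x => BinTree.checkPair (tab x) (e x) :=
  (PT.treeCases he (PT.const false) (g := fun x s t => BinTree.check (tab x) s t)
    (by fun_prop)).congr fun x => by rcases e x with _ | _ <;> rfl

theorem sz_filter_le {α : Type} [TreeRep α] (p : α → Bool) (l : List α) :
    sz (l.filter p) ≤ sz l := by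
  induction l with
  | nil => rfl
  | cons a l ih => cases h : p a <;> simp [h] <;> omega

@[fun_prop]
theorem PT.table {L : γ → List BinTree} {k : γ → ℕ} (hL : PT L) (hk : PT k) :
    PT fun x => BinTree.table (L x) (k x) := by
  have hp : PT fun x => pairs (L x) := by unfold pairs; fun_prop
  have hf : PT fun p : γ × List BinTree =>
      (pairs (L p.1)).filter fun e => BinTree.checkPair p.2 e :=
    PT.filter (by fun_prop) (hp.comp PT.fst')
  -- Every table is empty or a filtered copy of the same list of pairs, so its size does not depend
  -- on the number of rounds.
  have hB : PolyBounded fun x => _root_.sz (pairs (L x)) + 1 := by fun_prop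
  exact PT.iterate (f := fun x tab => (pairs (L x)).filter fun e => BinTree.checkPair tab e)
    hf hk (PT.const []) hB fun x k _ => by
      cases k with
      | zero => simp
      | succ k =>
        rw [Function.iterate_succ_apply']
        exact (sz_filter_le _ _).trans (Nat.le_succ _)

theorem PT.unifiable : PT _root_.unifiable := by
  refine (PT.listCases PT.parse (PT.const false) (g := fun w s l => match l with
    | [] => false
    | t :: _ => BinTree.edge (BinTree.table (BinTree.node s t).subs
      (_root_.sz (BinTree.node s t))) s t) ?_).congr fun w => by
        unfold _root_.unifiable
        rcases TermToken.parse w with _ | ⟨s, _ | ⟨t, l⟩⟩ <;> rfl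
  exact (PT.listCases (γ := (BinTree × List BinTree) × List TermToken) (l := fun p => p.1.2)
    (by fun_prop) (PT.const false) (g := fun p t _ =>
      BinTree.edge (BinTree.table (BinTree.node p.1.1 t).subs
        (_root_.sz (BinTree.node p.1.1 t))) p.1.1 t)
    (by fun_prop)).congr fun p => by rcases p.1.2 with _ | _ <;> rfl

end

/-! ### Correctness of the algorithm -/

namespace ACSignature

open BinTree TermToken
open FirstOrder.Language (Term)
open Computability (encodeNat)

/-- Carries matchings of trees over to matchings of terms. The map need not be injective, which
matters because all variables share one tree. -/
theorem matches_map {α β γ δ : Type} {r : γ → δ → Prop} {f : α → γ} {g : β → δ} {A : Multiset α}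
    {B : Multiset β} : Matches r (A.map f) (B.map g) ↔ Matches (fun a b => r (f a) (g b)) A B := by
  constructor
  · rintro ⟨C, hC, h⟩
    obtain ⟨B', hB, rfl⟩ : ∃ B' ≤ B, B'.map g = C := by
      induction B using Quotient.inductionOn
      induction C using Quotient.inductionOn
      obtain ⟨l, hl, hs⟩ := hC
      obtain ⟨m, hm, rfl⟩ := List.sublist_map_iff.1 hs
      exact ⟨m, hm.subperm, Quotient.sound hl⟩
    exact ⟨B', hB, Multiset.rel_map.1 h⟩
  · rintro ⟨B', hB, h⟩
    exact ⟨B'.map g, Multiset.map_le_map hB, Multiset.rel_map.2 h⟩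

theorem Matches.congr {α β : Type} {r r' : α → β → Prop} {A : Multiset α} {B : Multiset β}
    (h : ∀ a ∈ A, ∀ b ∈ B, (r a b ↔ r' a b)) : Matches r A B ↔ Matches r' A B :=
  exists_congr fun _ => and_congr_right fun hB =>
    ⟨fun hr => hr.mono fun a ha b hb => (h a ha b (Multiset.mem_of_le hB hb)).1,
      fun hr => hr.mono fun a ha b hb => (h a ha b (Multiset.mem_of_le hB hb)).2⟩

variable {S : ACSignature}

/-- The tree of a function symbol. -/
def label (S : ACSignature) (f : ℕ) : BinTree :=
  .node (TreeRep.rep (S.isAC f)) (TreeRep.rep (encodeNat f))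

theorem label_injective : Function.Injective S.label := fun f g h => by
  have := TreeRep.rep_injective (BinTree.node.inj h).2
  rw [← Computability.decode_encodeNat f, this, Computability.decode_encodeNat]

theorem isACLabel_label (f : ℕ) : isACLabel (S.label f) = S.isAC f := by
  rw [label, isACLabel]
  cases S.isAC f <;> rfl

/-- The tree of a term. -/
def toTree : S.Term → BinTree
  | .var _ => .leaf
  | .func f ts => build (S.isAC f.1) (encodeNat f.1) (List.ofFn fun i => toTree (ts i))

theorem foldr_bits (w : List Bool) (s : ParserState) :
    (w.map TermToken.bit).foldr parseToken s = (w ++ s.1, s.2) := by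
  induction w with
  | nil => rfl
  | cons b w ih => rw [List.map_cons, List.foldr_cons, ih]; rfl

/-- From the right, the arguments of a compound term are complete before its name and its tag are
met. The term is then put in front of its later siblings, so their order is preserved. -/
theorem foldr_encodeTerm (t : S.Term) (l : List BinTree) (ls : List (List BinTree)) :
    (encodeTerm t).foldr parseToken ([], l :: ls) = ([], (toTree t :: l) :: ls) := by
  induction t generalizing l ls with
  | var x =>
    rw [encodeTerm, List.foldr_cons, foldr_bits]
    rfl
  | func f ts ih =>
    have h : ∀ us : List S.Term, (∀ u ∈ us, ∀ (l : List BinTree) (ls : List (List BinTree)),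
        (encodeTerm u).foldr parseToken ([], l :: ls) = ([], (toTree u :: l) :: ls)) →
        ∀ (l : List BinTree) (ls : List (List BinTree)),
        (us.map encodeTerm).flatten.foldr parseToken ([], l :: ls) =
          ([], (us.map toTree ++ l) :: ls) := by
      intro us hus l ls
      induction us with
      | nil => rfl
      | cons u us ih' =>
        rw [List.map_cons, List.flatten_cons, List.foldr_append,
          ih' fun v hv => hus v (List.mem_cons_of_mem _ hv), hus u List.mem_cons_self]
        rfl
    have h := h (List.ofFn ts) fun u hu => by
      obtain ⟨i, rfl⟩ := (List.mem_ofFn' ts u).1 hu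
      exact ih i
    rw [List.map_ofFn, List.map_ofFn] at h
    have e : ∀ s, List.foldr parseToken s [closeParen] = (s.1, [] :: s.2) := fun _ => rfl
    have e' : ∀ s, List.foldr parseToken s [openParen] = s := fun _ => rfl
    rw [encodeTerm, List.foldr_cons, List.foldr_append, e, List.foldr_append]
    erw [h]
    rw [List.foldr_append, e', foldr_bits]
    simp only [List.append_nil]
    have e'' : parseToken (if S.isAC f.1 = true then acTag else freeTag) = reduce (S.isAC f.1) := by
      cases S.isAC f.1 <;> rfl
    rw [e'']
    rfl

theorem parse_encode (I : ACUnificationInstance) :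
    parse I.encode = [toTree I.t₁, toTree I.t₂] := by
  have e : ∀ s, List.foldr parseToken s [comma] = s := fun _ => rfl
  rw [parse, ACUnificationInstance.encode, List.foldr_append, List.foldr_append,
    foldr_encodeTerm, e, foldr_encodeTerm]

theorem isLeaf_toTree (t : S.Term) : (toTree t).isLeaf = true ↔ ∃ x, t = .var x := by
  cases t <;> simp [toTree, isLeaf, build]

theorem toTree_of_free {n : ℕ} {f : S.language.Functions n} (hf : S.isAC f.1 ≠ true)
    (ts : Fin n → S.Term) : toTree (.func f ts) =
      .node (S.label f.1) (TreeRep.rep (List.ofFn fun i => toTree (ts i))) := by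
  rw [toTree, build, Bool.eq_false_iff.2 hf, label, Bool.eq_false_iff.2 hf]
  rfl

/-- Trees are built from the inside, so nested products are already flat and splicing one level is
complete flattening. -/
theorem coe_splice {f : ℕ} (hf : S.isAC f = true) (t : S.Term) :
    ((splice (S.label f) (toTree t) : List BinTree) : Multiset BinTree) =
      (flat f t).map toTree := by
  induction t with
  | var x => rfl
  | func g ts ih =>
    by_cases hg : g.1 = f
    · subst hg
      have e : splice (S.label g.1) (toTree (.func g ts)) =
          (List.ofFn fun i => toTree (ts i)).flatMap (splice (S.label g.1)) := by
        rw [toTree, build, hf, label, hf, splice]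
        simp [toList_rep]
      rw [e, ← Multiset.coe_bind, ← Fin.univ_val_map, Multiset.bind_map, flat, if_pos rfl,
        Multiset.bind_congr fun i _ => ih i]
      exact (map_sum (Multiset.mapAddMonoidHom toTree) _ _).symm
    · rw [flat, if_neg hg, toTree, build, splice, ← label]
      simp [label_injective.eq_iff, hg]
      rfl

theorem toTree_func {n : ℕ} (f : S.language.Functions n) (ts : Fin n → S.Term) :
    ∃ l, toTree (.func f ts) = .node (S.label f.1) l := ⟨_, rfl⟩

theorem coe_toList {n : ℕ} {f : S.language.Functions n} (hf : S.isAC f.1 = true)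
    {ts : Fin n → S.Term} {l : BinTree} (hl : toTree (.func f ts) = .node (S.label f.1) l) :
    ((l.toList : List BinTree) : Multiset BinTree) = (flat f.1 (.func f ts)).map toTree := by
  rw [← coe_splice hf, hl, splice]
  simp

theorem vars_le_of_mem_flat {F : S.language.Functions 2} {a t : S.Term} (h : a ∈ flat F.1 t) :
    vars a ≤ vars t := by
  rw [← sum_vars_flat F t]
  exact Multiset.single_le_sum (fun _ _ => Multiset.zero_le _) _ (Multiset.mem_map_of_mem _ h)

theorem sz_lt_of_mem_toList {a l r : BinTree} (h : a ∈ r.toList) : sz a < sz (BinTree.node l r) := by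
  have := sz_le_of_mem h
  rw [sz_toList] at this
  rw [sz_node]
  omega

theorem edge_iff {tab : List BinTree} {a b : BinTree} :
    edge tab a b = true ↔ .node a b ∈ tab := by
  simp [edge]

theorem edge_table_succ {L : List BinTree} {k : ℕ} {a b : BinTree} :
    edge (table L (k + 1)) a b = true ↔ a ∈ L ∧ b ∈ L ∧ check (table L k) a b = true := by
  rw [edge_iff, table, Function.iterate_succ_apply', ← table, List.mem_filter]
  simp [pairs, checkPair, and_assoc]

section

variable {tab : List BinTree} {s t : S.Term}

theorem check_free_iff {n : ℕ} {f : S.language.Functions n} (hf : S.isAC f.1 ≠ true)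
    {ss ts : Fin n → S.Term} : check tab (toTree (.func f ss)) (toTree (.func f ts)) = true ↔
      ∀ i, edge tab (toTree (ss i)) (toTree (ts i)) = true := by
  have e : (List.ofFn fun i => toTree (ss i)).zip (List.ofFn fun i => toTree (ts i)) =
      List.ofFn fun i => (toTree (ss i), toTree (ts i)) :=
    List.ext_getElem (by simp) (by simp)
  rw [toTree_of_free hf, toTree_of_free hf, check, toList_rep, toList_rep, e, isACLabel_label,
    Bool.eq_false_iff.2 hf]
  simp

/-- The four cases of `checkAC`, according to which side has a variable factor. If only the second
side has one, `unif_iff_matches` is applied with the two terms exchanged. -/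
theorem check_ac_iff {F : S.language.Functions 2} (hF : S.isAC F.1 = true)
    (hn : (vars s + vars t).Nodup) {A B : List BinTree}
    (hA : (A : Multiset BinTree) = (flat F.1 s).map toTree)
    (hB : (B : Multiset BinTree) = (flat F.1 t).map toTree)
    (h : ∀ a ∈ flat F.1 s, ∀ b ∈ flat F.1 t,
      (edge tab (toTree a) (toTree b) = true ↔ Unif a b)) :
    checkAC tab A B = true ↔ Unif s t := by
  have any_iff : ∀ {u : S.Term} {C : List BinTree},
      (C : Multiset BinTree) = (flat F.1 u).map toTree →
        (C.any isLeaf = true ↔ ∃ x, .var x ∈ flat F.1 u) := by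
    intro u C hC
    simp only [List.any_eq_true, ← Multiset.mem_coe, hC, Multiset.mem_map]
    constructor
    · rintro ⟨_, ⟨a, ha, rfl⟩, hl⟩
      obtain ⟨x, rfl⟩ := (isLeaf_toTree a).1 hl
      exact ⟨x, ha⟩
    · rintro ⟨x, hx⟩
      exact ⟨_, ⟨_, hx, rfl⟩, rfl⟩
  have h₁ : Auction.assignable (edge tab) A B = true ↔ Matches Unif (flat F.1 s) (flat F.1 t) := by
    rw [Auction.assignable_iff, hA, hB, matches_map]
    exact Matches.congr h
  have h₂ : Auction.assignable (fun b a => edge tab a b) B A = true ↔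
      Matches Unif (flat F.1 t) (flat F.1 s) := by
    rw [Auction.assignable_iff, hA, hB, matches_map]
    exact Matches.congr fun b hb a ha => (h a ha b hb).trans ⟨Unif.symm, Unif.symm⟩
  have hcA : A.length = (flat F.1 s).card := by
    rw [← Multiset.coe_card, hA, Multiset.card_map]
  have hcB : B.length = (flat F.1 t).card := by
    rw [← Multiset.coe_card, hB, Multiset.card_map]
  have hn' : (vars t + vars s).Nodup := add_comm (vars s) (vars t) ▸ hn
  by_cases hx : ∃ x, .var x ∈ flat F.1 s <;> by_cases hy : ∃ y, .var y ∈ flat F.1 t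
  · rw [checkAC, (any_iff hA).2 hx, (any_iff hB).2 hy]
    obtain ⟨x, hx⟩ := hx
    obtain ⟨y, hy⟩ := hy
    exact ⟨fun _ => unif_of_mem_flat hF hn hx hy, fun _ => rfl⟩
  · rw [checkAC, (any_iff hA).2 hx, Bool.eq_false_iff.2 (mt (any_iff hB).1 hy),
      unif_iff_matches hF hn (not_exists.1 hy), ← h₁]
    simp [hx]
  · rw [checkAC, (any_iff hB).2 hy, Bool.eq_false_iff.2 (mt (any_iff hA).1 hx),
      (⟨Unif.symm, Unif.symm⟩ : Unif s t ↔ Unif t s),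
      unif_iff_matches hF hn' (not_exists.1 hx), ← h₂]
    simp [hy]
  · rw [checkAC, Bool.eq_false_iff.2 (mt (any_iff hA).1 hx),
      Bool.eq_false_iff.2 (mt (any_iff hB).1 hy), unif_iff_matches hF hn (not_exists.1 hy), ← h₁,
      hcA, hcB]
    simp [hx]

/-- A check consults the table only at pairs of arguments, whose first tree is strictly smaller, so
each round extends correctness by one unit of size. The list of subtrees also contains trees of no
term; their entries are never used here. -/
theorem edge_table_iff {u : BinTree} {k : ℕ} (hn : (vars s + vars t).Nodup)
    (hs : toTree s ∈ u.subs) (ht : toTree t ∈ u.subs) (hk : sz (toTree s) ≤ k) :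
    edge (table u.subs k) (toTree s) (toTree t) = true ↔ Unif s t := by
  induction k generalizing s t with
  | zero => have := sz_pos (toTree s); omega
  | succ k ih =>
    rw [edge_table_succ, and_iff_right hs, and_iff_right ht]
    cases s with
    | var x =>
      exact ⟨fun _ => unif_var_left (notMem_of_nodup_add hn (by simp [vars])), fun _ => rfl⟩
    | func f ss =>
    cases t with
    | var y =>
      rw [add_comm] at hn
      exact ⟨fun _ => (unif_var_left (notMem_of_nodup_add hn (by simp [vars]))).symm,
        fun _ => rfl⟩
    | func g ts =>
    by_cases hfg : f.1 = g.1
    · obtain rfl := arity_eq hfg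
      obtain rfl := Subtype.ext hfg
      obtain ⟨l, hl⟩ := toTree_func f ss
      obtain ⟨r, hr⟩ := toTree_func f ts
      have key : ∀ a b : S.Term, vars a ≤ vars (.func f ss) → vars b ≤ vars (.func f ts) →
          toTree a ∈ l.toList → toTree b ∈ r.toList →
          (edge (table u.subs k) (toTree a) (toTree b) = true ↔ Unif a b) := by
        intro a b ha hb hal hbr
        refine ih (Multiset.nodup_of_le (add_le_add ha hb) hn) ?_ ?_ ?_
        · exact mem_subs_of_mem_toList (mem_subs_of_node_mem (hl ▸ hs)).2 hal
        · exact mem_subs_of_mem_toList (mem_subs_of_node_mem (hr ▸ ht)).2 hbr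
        · have := sz_lt_of_mem_toList (l := S.label f.1) hal
          rw [← hl] at this
          omega
      by_cases hf : S.isAC f.1 = true
      · obtain rfl := f.2.2.symm.trans (S.arity_of_isAC f.1 f.2.1 hf)
        have hA := coe_toList hf hl
        have hB := coe_toList hf hr
        rw [hl, hr, check, isACLabel_label, hf]
        simp only [decide_true, Bool.true_and, cond_true]
        refine check_ac_iff hf hn hA hB fun a ha b hb =>
          key a b (vars_le_of_mem_flat ha) (vars_le_of_mem_flat hb) ?_ ?_
        · rw [← Multiset.mem_coe, hA]; exact Multiset.mem_map_of_mem _ ha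
        · rw [← Multiset.mem_coe, hB]; exact Multiset.mem_map_of_mem _ hb
      · rw [check_free_iff hf, unif_free hf hn]
        rw [toTree_of_free hf] at hl hr
        refine forall_congr' fun i => key _ _ ?_ ?_ ?_ ?_
        · exact Finset.single_le_sum (f := fun i => vars (ss i)) (fun _ _ => Multiset.zero_le _)
            (Finset.mem_univ i)
        · exact Finset.single_le_sum (f := fun i => vars (ts i)) (fun _ _ => Multiset.zero_le _)
            (Finset.mem_univ i)
        · rw [← (BinTree.node.inj hl).2, toList_rep]; exact (List.mem_ofFn' _ _).2 ⟨i, rfl⟩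
        · rw [← (BinTree.node.inj hr).2, toList_rep]; exact (List.mem_ofFn' _ _).2 ⟨i, rfl⟩
    · obtain ⟨l, hl⟩ := toTree_func f ss
      obtain ⟨r, hr⟩ := toTree_func g ts
      rw [hl, hr, check, decide_eq_false (label_injective.ne hfg)]
      simpa using not_unif_of_ne hfg

end

theorem unifiable_encode {I : ACUnificationInstance} (h : (vars I.t₁ + vars I.t₂).Nodup) :
    unifiable I.encode = true ↔ Unif I.t₁ I.t₂ := by
  have hm := mem_subs_of_node_mem (self_mem_subs (.node (toTree I.t₁) (toTree I.t₂)))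
  rw [unifiable, parse_encode]
  refine edge_table_iff h hm.1 hm.2 ?_
  rw [sz_node]
  omega

end ACSignature

/-! ### Input, output and the final machine -/

namespace StackProg

open Function

variable {i : List TermToken} {o m a b c : List Bool}

/-- Put a word on top of the main stack. -/
def pushWord : List Bool → StackProg Sym
  | [] => skip
  | x :: w => seq (pushWord w) (push .main x)

theorem runs_pushWord (w : List Bool) :
    Runs (pushWord w) (st i o m a b c) (st i o (w ++ m) a b c) (w.length + 1) := by
  induction w with
  | nil => exact .skip
  | cons x w ih => exact (ih.seq runs_pushMain).mono (by simp)

/-- Move the input to the main stack, as a list of tokens in the reverse order. -/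
def load : StackProg Sym :=
  loop .input fun x => seq (pushWord (TreeRep.rep x).code) (push .main true)

theorem sz_token_le (x : TermToken) : sz x ≤ 15 := by
  cases x with
  | bit b => cases b <;> decide
  | _ => decide

theorem runs_load (w u : List TermToken) :
    Runs load (st w o ((TreeRep.rep u).code ++ m) a b c)
      (st [] o ((TreeRep.rep (w.reverse ++ u)).code ++ m) a b c) (18 * w.length + 1) := by
  induction w generalizing u with
  | nil => exact .loop_nil rfl
  | cons x w ih =>
    have h : Runs (seq (pushWord (TreeRep.rep x).code) (push .main true))
        (st w o ((TreeRep.rep u).code ++ m) a b c)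
        (st w o ((TreeRep.rep (x :: u)).code ++ m) a b c) 17 :=
      ((runs_pushWord _).seq runs_pushMain).mono' (by simp [rep_cons, BinTree.code])
        (by have := sz_token_le x; rw [sz] at this; omega)
    refine (Runs.loop_cons (st w o ((TreeRep.rep u).code ++ m) a b c) rfl (by simp) h
      (ih (x :: u))).mono' ?_ ?_
    · simp
    · simp; omega

/-- Move the answer to the output. -/
def emit : StackProg Sym :=
  pop .main fun x => if x = some true then seq popMain (seq popMain (push .output true))
    else push .output false

theorem runs_emit (x : Bool) :
    Runs emit (st [] [] (TreeRep.rep x).code [] [] []) (st [] [x] [] [] [] []) 6 := by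
  cases x with
  | false =>
    exact (Runs.pop (st [] [] [] [] [] []) (some false) (by simp [rep_bool]; rfl) rfl
      (by simpa using Runs.push (by simp))).mono (T := 2) (by omega)
  | true =>
    exact Runs.pop (st [] [] [false, false] [] [] []) (some true) (by simp; rfl) rfl
      (runs_popMain.seq (runs_popMain.seq (.push (by simp))))

end StackProg

/-- A tree program that decides a property of words gives a machine that does so. -/
theorem PT.computableInPolyTime {α : Type} {f : List TermToken → Bool} (hf : PT f)
    (enc : α → List TermToken) :
    Nonempty (Turing.TM2ComputableInPolyTime enc Computability.encodeBool fun x => f (enc x)) := by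
  -- Loading the input reverses it, so the program starts by reversing it back.
  obtain ⟨p, T, ⟨q, hq⟩, hp⟩ := PT.comp hf (PT.reverse PT.id')
  let P : StackProg Sym := seq (push .main false) (seq load (seq p emit))
  -- Loading costs at most 18 steps per token. A token has a code of length at most 15, so a word of
  -- length `n` has size at most `16 * n + 1`. The constant covers the initial push, the end of the
  -- loading loop, the output and the final halting step.
  let t : Polynomial ℕ := 18 * Polynomial.X + 10 + q.comp (16 * Polynomial.X + 1)
  have hsz : ∀ w : List TermToken, sz w ≤ 16 * w.length + 1 := by
    intro w
    induction w with
    | nil => simp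
    | cons x w ih => have := sz_token_le x; rw [sz_cons, List.length_cons]; omega
  have run : ∀ w, Runs P (st w [] [] [] [] []) (st [] [f w] [] [] [] [])
      (t.eval w.length - 1) := by
    intro w
    have h₁ := runs_load (o := []) (m := []) (a := []) (b := []) (c := []) w []
    have h₂ := hp w.reverse []
    simp only [List.append_nil, List.reverse_reverse] at h₁ h₂
    refine (runs_pushMain.seq (h₁.seq (h₂.seq (runs_emit _)))).mono ?_
    have h₃ := (hq w.reverse).trans (Polynomial.eval_mono_nat q (hsz w.reverse))
    rw [List.length_reverse] at h₃
    simp [t]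
    omega
  refine ⟨{ tm := P.machine .input .output, inputAlphabet := Equiv.refl _,
            outputAlphabet := Equiv.refl _, time := t, outputsFun := fun x => ?_ }⟩
  have h : ∀ (k : Stk) (l : List (Sym k)), l.map (Equiv.refl (Sym k)).invFun = l :=
    fun k l => List.map_id l
  refine Classical.choice ?_
  obtain ⟨n, hn, h'⟩ := run (enc x)
  have e₁ : Function.update (β := fun k => List (Sym k)) (fun _ => []) Stk.input (enc x) =
      st (enc x) [] [] [] [] [] := by
    funext k; cases k <;> rfl
  have e₂ : Function.update (β := fun k => List (Sym k)) (fun _ => []) Stk.output [f (enc x)] =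
      st [] [f (enc x)] [] [] [] [] := by
    funext k; cases k <;> rfl
  have ht : n + 1 ≤ t.eval (enc x).length := by
    simp only [t, Polynomial.eval_add, Polynomial.eval_mul, Polynomial.eval_X,
      Polynomial.eval_ofNat] at hn ⊢
    omega
  rw [← e₁, ← e₂] at h'
  have out : ∀ u w, u = enc x → w = [f (enc x)] → Nonempty (Turing.TM2OutputsInTime
      (P.machine .input .output) u (some w) (t.eval (enc x).length)) := by
    rintro _ _ rfl rfl
    exact outputs_machine h' ht
  exact out _ _ (h .input _) (h .output _)

theorem mainTheorem8 :
    DecidableInPolyTime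
      (α := {I : ACUnificationInstance //
        ACSignature.IsDO I.t₁ ∧ ACSignature.IsDO I.t₂ ∧
          Disjoint I.t₁.varFinset I.t₂.varFinset})
      (fun I => I.1.encode)
      (fun I => ACSignature.ACUnifiable I.1.t₁ I.1.t₂) := by
  refine ⟨fun I => unifiable I.1.encode, fun I => ?_, PT.unifiable.computableInPolyTime _⟩
  obtain ⟨I, h₁, h₂, hd⟩ := I
  refine (ACSignature.unifiable_encode (Multiset.nodup_add.2 ⟨h₁.nodup, h₂.nodup, ?_⟩)).trans
    ACSignature.acUnifiable_iff.symm
  exact Multiset.disjoint_left.2 fun hx hx' =>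
    Finset.disjoint_left.1 hd (ACSignature.mem_vars.1 hx) (ACSignature.mem_vars.1 hx')
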